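/- **Problems.** Let $\Delta^m$ be the unit simplex of $\mathbb R^m$, $p,q\in\Delta^n$, and $\langle C,X\rangle=\sum_{a,j}C_{aj}X_{aj}$; norms are Euclidean. *(OT)* For $C\in\mathbb R_+^{n\times n}$, minimize $\langle C,X\rangle$ over $X\in\mathbb R_+^{n\times n}$ with $X\mathbf 1=p$, $X^\top\mathbf 1=q$. A matrix $\hat X\ge 0$ is an $\varepsilon$-approximate solution if $\langle C,\hat X\rangle-\langle C,X^*\rangle+\|\hat X\mathbf 1-p\|+\|\hat X^\top\mathbf 1-q\|\le\varepsilon$ for a minimizer $X^*$. *(EOT)* For $C^1,\dots,C^N\in\mathbb R_+^{n\times n}$, minimize $\sum_k\langle C^k,X^k\rangle$ over $X^k\in\mathbb R_+^{n\times n}$ with $\langle C^k,X^k\rangle=\langle C^l,X^l\rangle$ for all $k,l$, $(\sum_kX^k)\mathbf 1=p$, $(\sum_kX^k)^\top\mathbf 1=q$. A family $\hat X^k\ge 0$ is an $\varepsilon$-approximate solution if $$\sum_k\langle C^k,\hat X^k\rangle-\sum_k\langle C^k,(X^*)^k\rangle+\Big\|\Big(\sum_k\hat X^k\Big)\mathbf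 1-p\Big\|+\Big\|\Big(\sum_k\hat X^k\Big)^{\!\top}\mathbf 1-q\Big\|+\frac1N\sum_k\Big|\langle C^k,\hat X^k\rangle-\frac1N\sum_l\langle C^l,\hat X^l\rangle\Big|\le\varepsilon$$ for a minimizer $(X^*)^k$. **Decentralized form.** The agents $1,\dots,N$ are the vertices of a connected undirected graph with $N\ge 2$; $\mathcal N_i$ is the set of neighbours of $i$ and $L$ the Laplacian. Both problems have the form: minimize $\sum_i c_i^\top x_i$ subject to $\sum_iA_ix_i=b$, $x_i\in\mathbb R^d_+$. * D-OT: $N=n$, $d=n$; $x_i$, $c_i$ are the $i$-th columns of $X$, $C$; $A_i=\tilde M_i\in\mathbb R^{(2n-1)\times n}$ is $\begin{bmatrix}I_n\\ e_i\mathbf 1^\top\end{bmatrix}\in\mathbb R^{2n\times n}$ without its last row, and $b=[p;\tilde q]$ is $[p;q]$ without its last entry. * DE-OT: $d=n^2$; $x_i$, $c_i$ are the vectors of entries of $X^i$, $C^i$; $A_i=\begin{bmatrix}\tilde M\\ \tilde L_{*,i}c_i^\top\end{bmatrix}$ with $\tilde M=[\tilde M_1,\dots,\tilde M_n]$ and $\tilde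 L$ the first $N-1$ rows of $L$; $b=[p;\tilde q;0]$. **Algorithm**, with regularization parameter $\eta>0$ and parameters $\rho,\beta_i,\tau_i>0$. All of $x_i^0,y_i^0,z_i^0,\lambda_i^0,p_i^0$ are $0$; every agent iterates $$y_i^{k+1}=\Big[\Big(1-\frac1{\beta_i\tau_i}\Big)y_i^k+\frac1{\beta_i\tau_i}(x_i^k-\tau_iz_i^k)\Big]_+,$$ $$x_i^{k+1}=x_i^k-\frac1{\beta_i}\Big(c_i+\eta x_i^k+\frac1{\tau_i}(x_i^k-y_i^{k+1}-\tau_iz_i^k)+\frac{A_i^\top}{2\rho|\mathcal N_i|}\Big(A_ix_i^k-\frac bN-p_i^k+\rho\sum_{j\in\mathcal N_i}(\lambda_j^k+\lambda_i^k)\Big)\Big),$$ $$\lambda_i^{k+1}=\frac1{2|\mathcal N_i|}\Big(\sum_{j\in\mathcal N_i}(\lambda_j^k+\lambda_i^k)-\frac1\rho p_i^k+\frac1\rho\Big(A_ix_i^{k+1}-\frac bN\Big)\Big),$$ $$z_i^{k+1}=z_i^k+\frac1{\tau_i}(y_i^{k+1}-x_i^{k+1}),\qquad p_i^{k+1}=p_i^k+\rho\sum_{j\in\mathcal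 N_i}(\lambda_i^{k+1}-\lambda_j^{k+1}).$$ Let $\bar{\mathbf x}^k=\frac1k\sum_{t=1}^k\mathbf x^t$ (all agents stacked) and let $\hat{\mathbf x}(k)$ be its Euclidean projection onto the unit simplex $\Delta^{Nd}$. **Claim.** For every instance of D-OT with $n\ge 2$ and every instance of DE-OT with $n\ge 1$, $N\ge 2$ there is $\eta_0>0$, depending only on the instance, such that for all $\rho,\beta_i,\tau_i>0$ with, for all $i$, $$\beta_i\tau_i>1,\qquad\Big(\beta_i-\frac{\beta_i}{\beta_i\tau_i-1}-1\Big)I_d-\frac1{2\rho|\mathcal N_i|}A_i^\top A_i\succ0,$$ there is a constant $K_0>0$, independent of $\varepsilon$ and $\eta$, with the following property: for every $\varepsilon>0$, every $\eta\in(0,1]$ with $\eta\le\varepsilon$ or $\eta\le\eta_0$, and every $k\ge K_0/\varepsilon$, the projection $\hat{\mathbf x}(k)$ is an $\varepsilon$-approximate solution of (OT), respectively (EOT). Moreover, one iteration of agent $i$ can be carried out with $O(|\mathcal N_i|\,n)$ arithmetic operations for D-OT and $O(n^2+|\mathcal N_i|(2n+N))$ for DE-OT, with absolute constants: there is a straight-line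 program over $\mathbb R$ of that length (instructions $+,-,\cdot,/$, positive part, and loading a natural number), depending only on $n$, the graph and $i$, that computes the new $(x_i,y_i,z_i,\lambda_i,p_i)$ from the old ones, the vectors $\lambda_j^k,\lambda_j^{k+1}$ of the neighbours, $c_i$, $b$ and the parameters $\eta,\rho,\beta_i,\tau_i$. -/

import Mathlib

open Finset Matrix

namespace DecOT

/-! ## The inexact proximal dual consensus ADMM

The method is run on `min ∑ i, cᵢ ⬝ xᵢ + η/2 ‖xᵢ‖²` subject to `∑ i, Aᵢ xᵢ = b` and `x = y ≥ 0`.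
`κ` indexes the coordinates of the local variable of an agent, `μ` the coupling constraints,
and `ν` the neighbours of an agent. -/

/-- What an agent stores: primal variables `x`, `y`, multiplier `z` of `y = x`,
local copy `lam` of the multiplier of the coupling constraint, consensus multiplier `p`. -/
structure LocalState (κ μ : Type) where
  x : κ → ℝ
  y : κ → ℝ
  z : κ → ℝ
  lam : μ → ℝ
  p : μ → ℝ

/-- What an agent knows: its data `A`, `b`, `c`, the number `N` of agents,
the regularization parameter `η`, and the algorithm parameters `ρ`, `β`, `τ`. -/
structure Agent (κ μ : Type) where
  A : Matrix μ κ ℝ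
  b : μ → ℝ
  c : κ → ℝ
  N : ℕ
  η : ℝ
  ρ : ℝ
  β : ℝ
  τ : ℝ

namespace Agent

variable {κ μ ν : Type} [Fintype κ] [Fintype μ] [Fintype ν]

/-- `∑_{j ∈ 𝒩ᵢ} (λⱼ + λᵢ)`, where `msg j` is the vector `λⱼ` received from neighbour `j`. -/
def nbrSum (s : LocalState κ μ) (msg : ν → μ → ℝ) : μ → ℝ :=
  ∑ j, (msg j + s.lam)

/-- Projected gradient step in `y` over `y ≥ 0`. -/
noncomputable def yNext (a : Agent κ μ) (s : LocalState κ μ) : κ → ℝ := fun r =>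
  max ((1 - 1 / (a.β * a.τ)) * s.y r + 1 / (a.β * a.τ) * (s.x r - a.τ * s.z r)) 0

/-- Gradient step in `x`. -/
noncomputable def xNext (a : Agent κ μ) (s : LocalState κ μ) (msg : ν → μ → ℝ) : κ → ℝ :=
  s.x - (1 / a.β) •
    (a.c + a.η • s.x + (1 / a.τ) • (s.x - a.yNext s - a.τ • s.z)
      + (1 / (2 * a.ρ * (Fintype.card ν : ℝ))) •
        (a.Aᵀ *ᵥ (a.A *ᵥ s.x - (1 / (a.N : ℝ)) • a.b - s.p + a.ρ • nbrSum s msg)))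

noncomputable def lamNext (a : Agent κ μ) (s : LocalState κ μ) (msg : ν → μ → ℝ) : μ → ℝ :=
  (1 / (2 * (Fintype.card ν : ℝ))) •
    (nbrSum s msg - (1 / a.ρ) • s.p
      + (1 / a.ρ) • (a.A *ᵥ a.xNext s msg - (1 / (a.N : ℝ)) • a.b))

noncomputable def zNext (a : Agent κ μ) (s : LocalState κ μ) (msg : ν → μ → ℝ) : κ → ℝ :=
  s.z + (1 / a.τ) • (a.yNext s - a.xNext s msg)

/-- `msgNext j` is the updated vector `λⱼ` of neighbour `j`. -/
noncomputable def pNext (a : Agent κ μ) (s : LocalState κ μ) (msg msgNext : ν → μ → ℝ) :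
    μ → ℝ :=
  s.p + a.ρ • ∑ j, (a.lamNext s msg - msgNext j)

/-- One iteration of one agent. -/
noncomputable def step (a : Agent κ μ) (s : LocalState κ μ) (msg msgNext : ν → μ → ℝ) :
    LocalState κ μ where
  x := a.xNext s msg
  y := a.yNext s
  z := a.zNext s msg
  lam := a.lamNext s msg
  p := a.pNext s msg msgNext

end Agent

section Network

variable {V κ μ : Type} [Fintype V] [Fintype κ] [Fintype μ]

/-- One iteration of the whole network: agent `i` only uses its own state and the vectors `λⱼ`
of its neighbours `j`. -/
noncomputable def networkStep (G : SimpleGraph V) [DecidableRel G.Adj]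
    (agent : V → Agent κ μ) (s : V → LocalState κ μ) : V → LocalState κ μ := fun i =>
  (agent i).step (s i)
    (fun j : G.neighborSet i => (s j).lam)
    (fun j : G.neighborSet i =>
      (agent j).lamNext (s j) (fun l : G.neighborSet (j : V) => (s l).lam))

/-- The iterates of the algorithm, started at zero. -/
noncomputable def iterates (G : SimpleGraph V) [DecidableRel G.Adj]
    (agent : V → Agent κ μ) : ℕ → V → LocalState κ μ
  | 0 => fun _ => ⟨0, 0, 0, 0, 0⟩
  | k + 1 => networkStep G agent (iterates G agent k)

/-- The stacked ergodic average `x̄ᵏ = (1/k) ∑_{t=1}^k xᵗ`. -/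
noncomputable def ergodicAverage (G : SimpleGraph V) [DecidableRel G.Adj]
    (agent : V → Agent κ μ) (k : ℕ) : V × κ → ℝ := fun v =>
  (1 / (k : ℝ)) * ∑ t ∈ Icc 1 k, (iterates G agent t v.1).x v.2

/-- The step-size condition
`βᵢ τᵢ > 1` and `(βᵢ - βᵢ / (βᵢ τᵢ - 1) - 1) I - 1 / (2 ρ |𝒩ᵢ|) Aᵢᵀ Aᵢ ≻ 0`. -/
structure StepSizeCondition [DecidableEq κ] (G : SimpleGraph V) [DecidableRel G.Adj]
    (A : V → Matrix μ κ ℝ) (ρ : ℝ) (β τ : V → ℝ) : Prop where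
  rho_pos : 0 < ρ
  beta_pos : ∀ i, 0 < β i
  tau_pos : ∀ i, 0 < τ i
  one_lt : ∀ i, 1 < β i * τ i
  posDef : ∀ i,
    ((β i - β i / (β i * τ i - 1) - 1) • (1 : Matrix κ κ ℝ)
      - (1 / (2 * ρ * (G.degree i : ℝ))) • ((A i)ᵀ * A i)).PosDef

end Network

/-! ## Projection onto the simplex -/

/-- `x'` is the Euclidean projection of `x` onto the unit simplex. -/
def IsSimplexProjection {σ : Type} [Fintype σ] (x x' : σ → ℝ) : Prop :=
  x' ∈ stdSimplex ℝ σ ∧ ∀ w ∈ stdSimplex ℝ σ, ∑ v, (x v - x' v) ^ 2 ≤ ∑ v, (x v - w v) ^ 2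

theorem exists_isSimplexProjection {σ : Type} [Fintype σ] [Nonempty σ] (x : σ → ℝ) :
    ∃ x', IsSimplexProjection x x' := by
  classical
  obtain ⟨i⟩ := ‹Nonempty σ›
  obtain ⟨w, hw, hmin⟩ := (isCompact_stdSimplex ℝ σ).exists_isMinOn
    ⟨_, single_mem_stdSimplex ℝ i⟩
    (f := fun w : σ → ℝ => ∑ v, (x v - w v) ^ 2) (by fun_prop)
  exact ⟨w, hw, fun u hu => hmin hu⟩

/-! ## Optimal transport and equitable optimal transport -/

/-- The Euclidean norm of a vector. -/
noncomputable def euclNorm {σ : Type} [Fintype σ] (v : σ → ℝ) : ℝ := Real.sqrt (∑ i, v i ^ 2)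

/-- The transportation cost `⟨C, X⟩`. -/
def cost {n : ℕ} (C X : Matrix (Fin n) (Fin n) ℝ) : ℝ := ∑ a, ∑ j, C a j * X a j

/-- Feasible plans of the optimal transport problem. -/
def IsOTFeasible {n : ℕ} (p q : Fin n → ℝ) (X : Matrix (Fin n) (Fin n) ℝ) : Prop :=
  (∀ a j, 0 ≤ X a j) ∧ X *ᵥ 1 = p ∧ Xᵀ *ᵥ 1 = q

/-- `X` is a minimizer of the optimal transport problem. -/
def IsOTSolution {n : ℕ} (C : Matrix (Fin n) (Fin n) ℝ) (p q : Fin n → ℝ)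
    (X : Matrix (Fin n) (Fin n) ℝ) : Prop :=
  IsOTFeasible p q X ∧ ∀ Y, IsOTFeasible p q Y → cost C X ≤ cost C Y

/-- `X` is an `ε`-approximate solution of the optimal transport problem. -/
def IsApproxOT {n : ℕ} (C : Matrix (Fin n) (Fin n) ℝ) (p q : Fin n → ℝ) (ε : ℝ)
    (X : Matrix (Fin n) (Fin n) ℝ) : Prop :=
  (∀ a j, 0 ≤ X a j) ∧ ∃ Xs, IsOTSolution C p q Xs ∧
    cost C X - cost C Xs + euclNorm (X *ᵥ 1 - p) + euclNorm (Xᵀ *ᵥ 1 - q) ≤ ε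

/-- Feasible families of plans of the equitable optimal transport problem. -/
def IsEOTFeasible {n N : ℕ} (C : Fin N → Matrix (Fin n) (Fin n) ℝ) (p q : Fin n → ℝ)
    (X : Fin N → Matrix (Fin n) (Fin n) ℝ) : Prop :=
  (∀ k a j, 0 ≤ X k a j) ∧ (∀ k l, cost (C k) (X k) = cost (C l) (X l)) ∧
    (∑ k, X k) *ᵥ 1 = p ∧ (∑ k, X k)ᵀ *ᵥ 1 = q

/-- `X` is a minimizer of the equitable optimal transport problem. -/
def IsEOTSolution {n N : ℕ} (C : Fin N → Matrix (Fin n) (Fin n) ℝ) (p q : Fin n → ℝ)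
    (X : Fin N → Matrix (Fin n) (Fin n) ℝ) : Prop :=
  IsEOTFeasible C p q X ∧
    ∀ Y, IsEOTFeasible C p q Y → ∑ k, cost (C k) (X k) ≤ ∑ k, cost (C k) (Y k)

/-- `X` is an `ε`-approximate solution of the equitable optimal transport problem. -/
def IsApproxEOT {n N : ℕ} (C : Fin N → Matrix (Fin n) (Fin n) ℝ) (p q : Fin n → ℝ) (ε : ℝ)
    (X : Fin N → Matrix (Fin n) (Fin n) ℝ) : Prop :=
  (∀ k a j, 0 ≤ X k a j) ∧ ∃ Xs, IsEOTSolution C p q Xs ∧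
    (∑ k, cost (C k) (X k) - ∑ k, cost (C k) (Xs k))
      + (euclNorm ((∑ k, X k) *ᵥ 1 - p) + euclNorm ((∑ k, X k)ᵀ *ᵥ 1 - q))
      + (1 / (N : ℝ)) *
          ∑ k, |cost (C k) (X k) - (1 / (N : ℝ)) * ∑ l, cost (C l) (X l)| ≤ ε

/-! ## The two reformulations as constraint-coupled problems -/

/-- The rows of the marginal constraint with the last row removed. -/
abbrev MargRow (n : ℕ) : Type := Fin n ⊕ Fin (n - 1)

/-- All but the last of the indices. -/
def notLast {n : ℕ} (s : Fin (n - 1)) : Fin n := Fin.castLE (Nat.sub_le n 1) s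

/-- The block `Mᵢ` of the marginal matrix: it maps the `i`-th column `xᵢ` of a plan to its
contribution to the row sums and to the column sums. -/
def margBlock (n : ℕ) (i : Fin n) : Matrix (Fin n ⊕ Fin n) (Fin n) ℝ :=
  Matrix.fromRows 1 (Matrix.of fun s _ => if s = i then 1 else 0)

/-- `M̃ᵢ`: the block `Mᵢ` with its last row removed. -/
def margBlockT (n : ℕ) (i : Fin n) : Matrix (MargRow n) (Fin n) ℝ :=
  (margBlock n i).submatrix (Sum.map id notLast) id

/-- `[p; q̃]`. -/
def margRhs {n : ℕ} (p q : Fin n → ℝ) : MargRow n → ℝ := Sum.elim p (fun s => q (notLast s))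

/-- `M̃ = [M̃₁, …, M̃ₙ]`; the entry `(a, j)` of a plan is the `a`-th entry of its column `j`. -/
def margMatrixT (n : ℕ) : Matrix (MargRow n) (Fin n × Fin n) ℝ :=
  Matrix.of fun r v => margBlockT n v.2 r v.1

/-- The vector of entries of a cost matrix. -/
def vecEntries {n : ℕ} (C : Matrix (Fin n) (Fin n) ℝ) : Fin n × Fin n → ℝ := fun v => C v.1 v.2

/-- `Eᵢ = L̃_{*,i} cᵢᵀ`, where `L̃` is the Laplacian of the network without its last row. -/
noncomputable def equityBlock {n N : ℕ} (G : SimpleGraph (Fin N)) [DecidableRel G.Adj]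
    (C : Matrix (Fin n) (Fin n) ℝ) (i : Fin N) : Matrix (Fin (N - 1)) (Fin n × Fin n) ℝ :=
  Matrix.vecMulVec (fun s => G.lapMatrix ℝ (notLast s) i) (vecEntries C)

/-- The matrix `[M̃; Eᵢ]`. -/
noncomputable def eotBlock {n N : ℕ} (G : SimpleGraph (Fin N)) [DecidableRel G.Adj]
    (C : Matrix (Fin n) (Fin n) ℝ) (i : Fin N) :
    Matrix (MargRow n ⊕ Fin (N - 1)) (Fin n × Fin n) ℝ :=
  Matrix.fromRows (margMatrixT n) (equityBlock G C i)

/-- `[p; q̃; 0]`. -/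
def eotRhs {n : ℕ} (N : ℕ) (p q : Fin n → ℝ) : MargRow n ⊕ Fin (N - 1) → ℝ :=
  Sum.elim (margRhs p q) 0

/-- Agent `i` of decentralized optimal transport; `c` is its column of the cost matrix. -/
def otAgent {n : ℕ} (p q : Fin n → ℝ) (i : Fin n) (c : Fin n → ℝ) (η ρ β τ : ℝ) :
    Agent (Fin n) (MargRow n) where
  A := margBlockT n i
  b := margRhs p q
  c := c
  N := n
  η := η
  ρ := ρ
  β := β
  τ := τ

/-- Agent `i` of decentralized equitable optimal transport; `C` is its cost matrix. -/
noncomputable def eotAgent {n N : ℕ} (G : SimpleGraph (Fin N)) [DecidableRel G.Adj]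
    (p q : Fin n → ℝ) (i : Fin N) (C : Matrix (Fin n) (Fin n) ℝ) (η ρ β τ : ℝ) :
    Agent (Fin n × Fin n) (MargRow n ⊕ Fin (N - 1)) where
  A := eotBlock G C i
  b := eotRhs N p q
  c := vecEntries C
  N := N
  η := η
  ρ := ρ
  β := β
  τ := τ

/-! ## Arithmetic cost: straight-line programs over the reals -/

/-- An operand: an input or the result of the `k`-th instruction. -/
inductive Operand (I : Type) where
  | inp (v : I)
  | reg (k : ℕ)

/-- The instructions, each of unit cost: load a natural number, the four arithmetic operations,
and the positive part. -/
inductive Instr (I : Type) where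
  | nat (m : ℕ)
  | add (u v : Operand I)
  | sub (u v : Operand I)
  | mul (u v : Operand I)
  | div (u v : Operand I)
  | pos (u : Operand I)

noncomputable def Operand.val {I : Type} (input : I → ℝ) (regs : List ℝ) : Operand I → ℝ
  | .inp v => input v
  | .reg k => regs.getD k 0

noncomputable def Instr.val {I : Type} (input : I → ℝ) (regs : List ℝ) : Instr I → ℝ
  | .nat m => m
  | .add u v => u.val input regs + v.val input regs
  | .sub u v => u.val input regs - v.val input regs
  | .mul u v => u.val input regs * v.val input regs
  | .div u v => u.val input regs / v.val input regs
  | .pos u => max (u.val input regs) 0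

/-- The results of all instructions, in order, appended to `regs`. -/
noncomputable def runCode {I : Type} (input : I → ℝ) : List (Instr I) → List ℝ → List ℝ
  | [], regs => regs
  | ins :: code, regs => runCode input code (regs ++ [ins.val input regs])

/-- A straight-line program with inputs `I` and outputs `O`. -/
structure Program (I O : Type) where
  code : List (Instr I)
  out : O → Operand I

/-- The number of arithmetic operations. -/
def Program.opCount {I O : Type} (P : Program I O) : ℕ := P.code.length

noncomputable def Program.eval {I O : Type} (P : Program I O) (input : I → ℝ) : O → ℝ :=
  fun o => (P.out o).val input (runCode input P.code [])

/-- The numbers an agent works with in one iteration: its state, the vectors received from its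
neighbours, its cost vector, the right-hand side and the parameters. -/
inductive AgentInput (κ μ ν : Type) where
  | x (r : κ)
  | y (r : κ)
  | z (r : κ)
  | lam (r : μ)
  | p (r : μ)
  | msg (j : ν) (r : μ)
  | msgNext (j : ν) (r : μ)
  | c (r : κ)
  | b (r : μ)
  | η
  | ρ
  | β
  | τ

/-- The entries of the new state of an agent. -/
inductive AgentOutput (κ μ : Type) where
  | x (r : κ)
  | y (r : κ)
  | z (r : κ)
  | lam (r : μ)
  | p (r : μ)

def inputValues {κ μ ν : Type} (a : Agent κ μ) (s : LocalState κ μ) (msg msgNext : ν → μ → ℝ) :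
    AgentInput κ μ ν → ℝ
  | .x r => s.x r
  | .y r => s.y r
  | .z r => s.z r
  | .lam r => s.lam r
  | .p r => s.p r
  | .msg j r => msg j r
  | .msgNext j r => msgNext j r
  | .c r => a.c r
  | .b r => a.b r
  | .η => a.η
  | .ρ => a.ρ
  | .β => a.β
  | .τ => a.τ

def stateValues {κ μ : Type} (s : LocalState κ μ) : AgentOutput κ μ → ℝ
  | .x r => s.x r
  | .y r => s.y r
  | .z r => s.z r
  | .lam r => s.lam r
  | .p r => s.p r

/-- `P` performs one iteration of the agent `a`, for all states and all received vectors. -/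
def Implements {κ μ ν : Type} [Fintype κ] [Fintype μ] [Fintype ν]
    (P : Program (AgentInput κ μ ν) (AgentOutput κ μ)) (a : Agent κ μ) : Prop :=
  ∀ (s : LocalState κ μ) (msg msgNext : ν → μ → ℝ),
    P.eval (inputValues a s msg msgNext) = stateValues (a.step s msg msgNext)

end DecOT

/-! The rate comes from a single potential. Fix a feasible `x ≥ 0`, a test multiplier `z` for the
constraint `y = x` and a test multiplier `Λ` for the coupling constraint. The regularized Lagrangian
gap of the new iterate, tested with `z` and `Λ`, is at most the decrease of a nonnegative quadratic
potential in that iteration (`networkPotential_decrease`).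

The primal part of the potential consists of weighted squared distances minus a quadratic form in
`A`. The step-size condition keeps it nonnegative and absorbs the error of linearizing the coupling
term and the regularizer. For the dual part, `iterates_p` shows that `p` is `ρ` times the Laplacian
of the accumulated `λ`. The coupling residual is therefore a signless Laplacian of the last
increment of `λ` plus a Laplacian of the accumulated `λ`, and both are polarized edge by edge
(`dual_decrease`).

Telescoping, convexity of the objective, and test multipliers equal to `P` times the signs of the
averaged residuals give `ergodic_bound`: objective gap plus `P` times the ℓ¹ residuals is at most `C
/ k`. The constant `C` does not depend on `η ∈ (0, 1]`, because the initial potential does not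
contain `η` and the test data lie in a fixed box.

Hoffman's bound turns this into an approximate solution of the unregularized linear program
(`approx_of_penalized_bound`): a large enough `P` makes the ℓ¹ penalty exact. If `η ≤ ε`, the
regularizer costs at most `η / 2`. If `η ≤ η₀`, the comparison point is instead a point of the
optimal face near the average. The gain in squared norm is then Lipschitz in the distance to that
face, which Hoffman's bound controls by residual plus gap, so a small `η` lets the left-hand side
absorb it. Feasible points lie in the simplex, so the final projection multiplies the distance to
them by at most a constant.

The operation counts rest on sharing sums: the marginal blocks contain one repeated sum, and the
equity block has rank one. -/

namespace DecOT

/-! ## Hoffman's error bound for a polyhedron in standard form -/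

/-- A matrix is bounded below, uniformly, on the vectors `u` such that no nonzero vector of its
kernel is conformal to `u`. -/
theorem exists_lower_bound_of_conformal {m σ : Type*} [Fintype m] [Fintype σ]
    (M : Matrix m σ ℝ) :
    ∃ δ : ℝ, 0 < δ ∧ ∀ u : σ → ℝ,
      (∀ w : σ → ℝ, M *ᵥ w = 0 → (∀ v, w v * (SignType.sign (u v) : ℝ) = |w v|) → w = 0) →
      δ * ∑ v, |u v| ≤ ∑ r, |(M *ᵥ u) r| := by
  classical
  have key : ∀ s : σ → SignType, ∃ δ : ℝ, 0 < δ ∧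
      ((∀ w : σ → ℝ, M *ᵥ w = 0 → (∀ v, w v * (s v : ℝ) = |w v|) → w = 0) →
        ∀ w : σ → ℝ, ∑ v, |w v| = 1 → (∀ v, w v * (s v : ℝ) = |w v|) →
          δ ≤ ∑ r, |(M *ᵥ w) r|) := by
    intro s
    -- The ℓ¹ unit sphere within the closed orthant of the pattern `s`; a zero in the pattern forces
    -- `w v = 0`. On this compact set the residual attains its minimum, which is positive unless a
    -- kernel vector lies there.
    set K : Set (σ → ℝ) := {w | ∑ v, |w v| = 1 ∧ ∀ v, w v * (s v : ℝ) = |w v|} with hK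
    have hKc : IsCompact K := by
      apply Metric.isCompact_of_isClosed_isBounded
      · have hKi : K = {w | ∑ v, |w v| = 1} ∩ ⋂ v, {w | w v * (s v : ℝ) = |w v|} := by
          ext w; simp [hK]
        rw [hKi]
        exact (isClosed_eq (by fun_prop) continuous_const).inter
          (isClosed_iInter fun v => isClosed_eq (by fun_prop) (by fun_prop))
      · refine (Metric.isBounded_Icc (fun _ => (-1 : ℝ)) (fun _ => 1)).subset ?_
        intro w hw
        have h1 : ∀ v, |w v| ≤ 1 := fun v => by
          rw [← hw.1]; exact single_le_sum (fun i _ => abs_nonneg (w i)) (mem_univ v)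
        exact ⟨fun v => (abs_le.mp (h1 v)).1, fun v => (abs_le.mp (h1 v)).2⟩
    rcases K.eq_empty_or_nonempty with h0 | hne
    · exact ⟨1, one_pos, fun _ w h1 h2 => absurd (show w ∈ K from ⟨h1, h2⟩) (by simp [h0])⟩
    · have hcont : Continuous fun w : σ → ℝ => ∑ r, |(M *ᵥ w) r| := by
        refine continuous_finsetSum _ fun r _ => ?_
        exact ((continuous_apply r).comp (continuous_const.matrix_mulVec continuous_id)).abs
      obtain ⟨w₀, hw₀, hmin⟩ := hKc.exists_isMinOn hne hcont.continuousOn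
      by_cases hgood : ∀ w : σ → ℝ, M *ᵥ w = 0 → (∀ v, w v * (s v : ℝ) = |w v|) → w = 0
      · refine ⟨∑ r, |(M *ᵥ w₀) r|, ?_, fun _ w h1 h2 => hmin (show w ∈ K from ⟨h1, h2⟩)⟩
        refine lt_of_le_of_ne (sum_nonneg fun _ _ => abs_nonneg _) fun h => ?_
        have hz : M *ᵥ w₀ = 0 := by
          funext r
          have := (sum_eq_zero_iff_of_nonneg fun r _ => abs_nonneg ((M *ᵥ w₀) r)).mp h.symm r
            (mem_univ r)
          simpa using this
        have := hgood w₀ hz hw₀.2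
        have h1 := hw₀.1
        simp [this] at h1
      · exact ⟨1, one_pos, fun h => absurd h hgood⟩
  choose δ hδ hb using key
  -- There are finitely many sign patterns, so one constant serves them all.
  obtain ⟨s₀, hs₀⟩ := Finite.exists_min δ
  refine ⟨δ s₀, hδ s₀, fun u hu => ?_⟩
  rcases (sum_nonneg fun v _ => abs_nonneg (u v) : 0 ≤ ∑ v, |u v|).eq_or_lt with h0 | hpos
  · rw [← h0, mul_zero]; exact sum_nonneg fun _ _ => abs_nonneg _
  · set T := ∑ v, |u v|
    have h1 := hb (fun v => SignType.sign (u v)) hu (fun v => T⁻¹ * u v) ?_ ?_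
    · have h2 : ∑ r, |(M *ᵥ fun v => T⁻¹ * u v) r| = T⁻¹ * ∑ r, |(M *ᵥ u) r| := by
        rw [mul_sum]
        refine sum_congr rfl fun r _ => ?_
        have : (fun v => T⁻¹ * u v) = T⁻¹ • u := rfl
        rw [this, mulVec_smul, Pi.smul_apply, smul_eq_mul, abs_mul, abs_of_pos (inv_pos.mpr hpos)]
      rw [h2, inv_mul_eq_div, le_div_iff₀ hpos] at h1
      exact (mul_le_mul_of_nonneg_right (hs₀ _) hpos.le).trans h1
    · simp only [abs_mul, abs_of_pos (inv_pos.mpr hpos)]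
      rw [← mul_sum]
      exact inv_mul_cancel₀ hpos.ne'
    · intro v
      rw [abs_mul, abs_of_pos (inv_pos.mpr hpos), mul_assoc, self_mul_sign]

/-- Supplies the step length with which a point moves along a conformal direction `w` without
overshooting its target. -/
theorem exists_pos_mul_abs_le {σ : Type*} [Finite σ] (w u : σ → ℝ)
    (h : ∀ v, u v = 0 → w v = 0) : ∃ t : ℝ, 0 < t ∧ ∀ v, t * |w v| ≤ |u v| := by
  have : ∀ᶠ t : ℝ in nhdsWithin 0 (Set.Ioi 0), ∀ v, t * |w v| ≤ |u v| := by
    rw [Filter.eventually_all]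
    intro v
    by_cases hu : u v = 0
    · simp [hu, h v hu]
    · have hc : Filter.Tendsto (fun t : ℝ => t * |w v|) (nhdsWithin 0 (Set.Ioi 0))
          (nhds (0 * |w v|)) :=
        ((continuous_id.mul continuous_const).tendsto 0).mono_left nhdsWithin_le_nhds
      rw [zero_mul] at hc
      filter_upwards [hc.eventually (gt_mem_nhds (abs_pos.mpr hu))] with t ht using ht.le
  obtain ⟨t, h1, h2⟩ := (this.and self_mem_nhdsWithin).exists
  exact ⟨t, h2, h1⟩

/-- Take the feasible `x` nearest to `y` in ℓ¹. A nonzero kernel vector conformal to `x - y` would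
allow a move from `x` towards `y` in every coordinate of its support, staying feasible and getting
strictly closer. So there is none, and the uniform lower bound applies to `x - y`. -/
theorem hoffman {m σ : Type*} [Fintype m] [Fintype σ] (M : Matrix m σ ℝ) (d : m → ℝ)
    (hne : ∃ x : σ → ℝ, (∀ v, 0 ≤ x v) ∧ M *ᵥ x = d) :
    ∃ H : ℝ, 0 < H ∧ ∀ y : σ → ℝ, (∀ v, 0 ≤ y v) →
      ∃ x : σ → ℝ, (∀ v, 0 ≤ x v) ∧ M *ᵥ x = d ∧
        ∑ v, |y v - x v| ≤ H * ∑ r, |(M *ᵥ y) r - d r| := by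
  obtain ⟨δ, hδ, hb⟩ := exists_lower_bound_of_conformal M
  obtain ⟨x₀, hx₀, hMx₀⟩ := hne
  refine ⟨δ⁻¹, inv_pos.mpr hδ, fun y hy => ?_⟩
  set D := ∑ v, |y v - x₀ v| with hD
  set S : Set (σ → ℝ) := {x | (∀ v, 0 ≤ x v) ∧ M *ᵥ x = d ∧ ∑ v, |y v - x v| ≤ D} with hS
  have hSc : IsCompact S := by
    apply Metric.isCompact_of_isClosed_isBounded
    · have hSi : S = (⋂ v, {x | 0 ≤ x v}) ∩ ({x | M *ᵥ x = d} ∩ {x | ∑ v, |y v - x v| ≤ D}) := by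
        ext x; simp [hS]
      rw [hSi]
      exact (isClosed_iInter fun v => isClosed_le continuous_const (continuous_apply v)).inter
        ((isClosed_eq (continuous_const.matrix_mulVec continuous_id) continuous_const).inter
          (isClosed_le (by fun_prop) continuous_const))
    · refine (Metric.isBounded_Icc (fun v => y v - D) (fun v => y v + D)).subset ?_
      intro x hx
      have h1 : ∀ v, |y v - x v| ≤ D := fun v =>
        (single_le_sum (f := fun v => |y v - x v|) (fun i _ => abs_nonneg _) (mem_univ v)).trans
          hx.2.2
      exact ⟨fun v => by linarith [(abs_le.mp (h1 v)).2], fun v => by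
        linarith [(abs_le.mp (h1 v)).1]⟩
  obtain ⟨x, hx, hmin⟩ := hSc.exists_isMinOn ⟨x₀, hx₀, hMx₀, le_rfl⟩
    (f := fun x => ∑ v, |y v - x v|) (by fun_prop)
  refine ⟨x, hx.1, hx.2.1, ?_⟩
  have h1 := hb (fun v => x v - y v) ?_
  · have h2 : M *ᵥ (fun v => x v - y v) = d - M *ᵥ y := by
      rw [← hx.2.1, ← mulVec_sub]; rfl
    rw [h2] at h1
    rw [inv_mul_eq_div, le_div_iff₀ hδ, mul_comm]
    simpa only [abs_sub_comm, Pi.sub_apply] using h1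
  · intro w hMw hw
    by_contra hne
    obtain ⟨t, ht, htw⟩ := exists_pos_mul_abs_le w (fun v => x v - y v) fun v hv => by
      have := hw v
      simp only [hv, sign_zero, SignType.coe_zero, mul_zero] at this
      exact abs_eq_zero.mp this.symm
    have hdist : ∀ v, |y v - (x v - t * w v)| = |y v - x v| - t * |w v| := by
      intro v
      have h1 := htw v
      have h2 := hw v
      rcases lt_trichotomy (x v - y v) 0 with h | h | h
      · simp only [sign_neg h, SignType.coe_neg_one] at h2
        rw [abs_of_neg h] at h1
        rw [← h2] at h1 ⊢
        rw [abs_of_nonneg (by linarith), abs_of_nonneg (by linarith)]; ring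
      · simp only [h, sign_zero, SignType.coe_zero, mul_zero] at h2
        have h3 : w v = 0 := abs_eq_zero.mp h2.symm
        simp [h3]
      · simp only [sign_pos h, SignType.coe_one] at h2
        rw [abs_of_pos h] at h1
        rw [← h2] at h1 ⊢
        rw [abs_of_nonpos (by linarith), abs_of_nonpos (by linarith)]; ring
    have hsum : ∑ v, |y v - (x v - t * w v)| = ∑ v, |y v - x v| - t * ∑ v, |w v| := by
      simp only [hdist, sum_sub_distrib, mul_sum]
    have hwpos : 0 < ∑ v, |w v| := by
      obtain ⟨v, hv⟩ := Function.ne_iff.mp hne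
      exact sum_pos' (fun i _ => abs_nonneg _) ⟨v, mem_univ v, abs_pos.mpr hv⟩
    have hmem : (fun v => x v - t * w v) ∈ S := by
      refine ⟨fun v => ?_, ?_, ?_⟩
      -- The moved coordinate lies between `x v` and `y v`, which are both nonnegative.
      · have h1 := hdist v
        have h2 := hx.1 v
        have h3 := hy v
        have h4 := mul_nonneg ht.le (abs_nonneg (w v))
        by_contra hneg
        push Not at hneg
        rw [abs_of_pos (by linarith)] at h1
        have h5 : |y v - x v| ≤ max (y v) (x v) := abs_le.mpr
          ⟨by linarith [le_max_right (y v) (x v)], by linarith [le_max_left (y v) (x v)]⟩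
        rcases le_total (x v) (y v) with h | h
        · rw [abs_of_nonneg (by linarith)] at h1
          nlinarith [abs_nonneg (w v), le_abs_self (w v)]
        · have := htw v
          rw [abs_of_nonneg (by linarith : 0 ≤ x v - y v)] at this
          nlinarith [le_abs_self (w v)]
      · have : (fun v => x v - t * w v) = x - t • w := rfl
        rw [this, mulVec_sub, mulVec_smul, hMw, hx.2.1]; simp
      · rw [hsum]; nlinarith [hx.2.2]
    have h6 : ∑ v, |y v - x v| ≤ ∑ v, |y v - (x v - t * w v)| := hmin hmem
    rw [hsum] at h6
    nlinarith

/-! ## Quadratic forms of a graph -/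

section Graph

variable {V : Type} [Fintype V] (G : SimpleGraph V) [DecidableRel G.Adj]

theorem sum_neighborSet (i : V) (f : V → ℝ) :
    ∑ j : G.neighborSet i, f j = ∑ j, if G.Adj i j then f j else 0 := by
  rw [← Finset.sum_filter]
  exact (Finset.sum_subtype _ (by simp) f).symm

/-- The bilinear form of the signless Laplacian, written over edges. The sum over ordered pairs
meets each edge twice, hence the factor `1 / 2`. -/
theorem sum_mul_sum_add_adj (u v : V → ℝ) :
    ∑ i, u i * ∑ j, (if G.Adj i j then v i + v j else 0)
      = 1 / 2 * ∑ i, ∑ j, if G.Adj i j then (u i + u j) * (v i + v j) else 0 := by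
  have h1 : ∑ i, u i * ∑ j, (if G.Adj i j then v i + v j else 0)
      = ∑ i, ∑ j, if G.Adj i j then u i * (v i + v j) else 0 := by
    simp only [mul_sum, mul_ite, mul_zero]
  have h2 : ∑ i, ∑ j, (if G.Adj i j then u i * (v i + v j) else 0)
      = ∑ i, ∑ j, if G.Adj i j then u j * (v i + v j) else 0 := by
    rw [sum_comm]
    simp only [G.adj_comm, add_comm]
  have h3 : ∑ i, ∑ j, (if G.Adj i j then (u i + u j) * (v i + v j) else 0)
      = ∑ i, ∑ j, (if G.Adj i j then u i * (v i + v j) else 0)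
        + ∑ i, ∑ j, if G.Adj i j then u j * (v i + v j) else 0 := by
    simp only [← sum_add_distrib]
    refine sum_congr rfl fun i _ => sum_congr rfl fun j _ => ?_
    split_ifs <;> ring
  rw [h1, h3, ← h2]; ring

theorem sum_mul_sum_sub_adj (u v : V → ℝ) :
    ∑ i, u i * ∑ j, (if G.Adj i j then v i - v j else 0)
      = 1 / 2 * ∑ i, ∑ j, if G.Adj i j then (u i - u j) * (v i - v j) else 0 := by
  have h1 : ∑ i, u i * ∑ j, (if G.Adj i j then v i - v j else 0)
      = ∑ i, ∑ j, if G.Adj i j then u i * (v i - v j) else 0 := by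
    simp only [mul_sum, mul_ite, mul_zero]
  have h2 : ∑ i, ∑ j, (if G.Adj i j then u i * (v i - v j) else 0)
      = ∑ i, ∑ j, if G.Adj i j then u j * (v j - v i) else 0 := by
    rw [sum_comm]
    simp only [G.adj_comm]
  have h3 : ∑ i, ∑ j, (if G.Adj i j then (u i - u j) * (v i - v j) else 0)
      = ∑ i, ∑ j, (if G.Adj i j then u i * (v i - v j) else 0)
        + ∑ i, ∑ j, if G.Adj i j then u j * (v j - v i) else 0 := by
    simp only [← sum_add_distrib]
    refine sum_congr rfl fun i _ => sum_congr rfl fun j _ => ?_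
    split_ifs <;> ring
  rw [h1, h3, ← h2]; ring

/-- On vectors with zero sum, the Laplacian of a connected graph has a linear right inverse. -/
theorem exists_laplacian_rightInverse (hG : G.Connected) :
    ∃ R : Matrix V V ℝ, ∀ v : V → ℝ, ∑ i, v i = 0 → ∀ i,
      ∑ j, (if G.Adj i j then (R *ᵥ v) i - (R *ᵥ v) j else 0) = v i := by
  classical
  have := hG.nonempty
  set L := G.lapMatrix ℝ with hL
  -- Adding the all-ones matrix removes the constants, which form the kernel of `L`. Since `L *ᵥ u`
  -- always has zero sum, a solution of `(L + J) u = v` with `v` of zero sum has zero sum itself,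
  -- hence solves `L u = v`.
  set J : Matrix V V ℝ := Matrix.of fun _ _ => 1 with hJ
  have hJv : ∀ u i, (J *ᵥ u) i = ∑ j, u j := fun u i => by simp [hJ, mulVec, dotProduct]
  have hLs : ∀ u, ∑ i, (L *ᵥ u) i = 0 := by
    intro u
    have h := G.lapMatrix_mulVec_const_eq_zero (R := ℝ)
    have : ∑ i, (L *ᵥ u) i = (fun _ => (1 : ℝ)) ⬝ᵥ (L *ᵥ u) := by simp [dotProduct]
    rw [this, dotProduct_mulVec, ← mulVec_transpose, (G.isSymm_lapMatrix (R := ℝ)).eq, h, zero_dotProduct]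
  have hsum : ∀ u v, (L + J) *ᵥ u = v → ∑ i, v i = 0 → ∑ j, u j = 0 := by
    intro u v h hv
    have h1 : ∑ i, ((L + J) *ᵥ u) i = (Fintype.card V : ℝ) * ∑ j, u j := by
      simp only [add_mulVec, Pi.add_apply, sum_add_distrib, hLs, hJv]; simp
    rw [h, hv] at h1
    have : (Fintype.card V : ℝ) ≠ 0 := by exact_mod_cast Fintype.card_ne_zero
    simpa [this] using h1.symm
  have hinj : ∀ u, (L + J) *ᵥ u = 0 → u = 0 := by
    intro u hu
    have h0 := hsum u 0 hu (by simp)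
    have h1 : L *ᵥ u = 0 := by
      funext i
      have := congrFun hu i
      rw [add_mulVec, Pi.add_apply, hJv, h0, add_zero] at this
      exact this
    have h2 := (G.lapMatrix_mulVec_eq_zero_iff_forall_reachable).mp h1
    funext i
    have h3 : ∑ j, u j = (Fintype.card V : ℝ) * u i := by
      rw [sum_congr rfl fun j _ => h2 j i (hG.preconnected j i)]; simp
    rw [h0] at h3
    have : (Fintype.card V : ℝ) ≠ 0 := by exact_mod_cast Fintype.card_ne_zero
    simpa [this] using h3.symm
  have hdet : IsUnit (L + J).det := by
    rw [isUnit_iff_ne_zero]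
    intro h
    obtain ⟨u, hu, hu0⟩ := Matrix.exists_mulVec_eq_zero_iff.mpr h
    exact hu (hinj u hu0)
  refine ⟨(L + J)⁻¹, fun v hv i => ?_⟩
  set s := (L + J)⁻¹ *ᵥ v with hs
  have h1 : (L + J) *ᵥ s = v := by
    rw [hs, mulVec_mulVec, Matrix.mul_nonsing_inv _ hdet, one_mulVec]
  have h2 := hsum s v h1 hv
  have h3 := congrFun h1 i
  rw [add_mulVec, Pi.add_apply, hJv, h2, add_zero, hL, G.lapMatrix_mulVec_apply,
    SimpleGraph.degree_eq_sum_if_adj, SimpleGraph.neighborFinset_eq_filter, sum_filter, sum_mul,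
    ← sum_sub_distrib] at h3
  rw [← h3]
  refine sum_congr rfl fun j _ => ?_
  split_ifs <;> ring

/-- The decrease of the dual part of the potential, for one coupling constraint. -/
theorem dual_decrease {ρ : ℝ} (hρ : 0 < ρ) (lam lam' S s : V → ℝ) (Λ : ℝ) :
    -∑ i, (lam' i - Λ) *
        (ρ * ∑ j, (if G.Adj i j then (lam' i - lam i) + (lam' j - lam j) else 0)
          + ρ * ∑ j, (if G.Adj i j then (S i + lam' i - s i) - (S j + lam' j - s j) else 0))
      ≤ (ρ / 4 * ∑ i, ∑ j, (if G.Adj i j then ((lam i - Λ) + (lam j - Λ)) ^ 2 else 0)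
          + ρ / 4 * ∑ i, ∑ j, (if G.Adj i j then ((S i - s i) - (S j - s j)) ^ 2 else 0))
        - (ρ / 4 * ∑ i, ∑ j, (if G.Adj i j then ((lam' i - Λ) + (lam' j - Λ)) ^ 2 else 0)
          + ρ / 4 * ∑ i, ∑ j,
            (if G.Adj i j then ((S i + lam' i - s i) - (S j + lam' j - s j)) ^ 2 else 0)) := by
  have h1 := sum_mul_sum_add_adj G (fun i => lam' i - Λ) (fun i => lam' i - lam i)
  have h2 := sum_mul_sum_sub_adj G (fun i => lam' i - Λ) (fun i => S i + lam' i - s i)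
  have h3 : ∀ i, (lam' i - Λ) *
        (ρ * ∑ j, (if G.Adj i j then (lam' i - lam i) + (lam' j - lam j) else 0)
          + ρ * ∑ j, (if G.Adj i j then (S i + lam' i - s i) - (S j + lam' j - s j) else 0))
      = ρ * ((lam' i - Λ) * ∑ j, (if G.Adj i j then (lam' i - lam i) + (lam' j - lam j) else 0))
        + ρ * ((lam' i - Λ) *
          ∑ j, (if G.Adj i j then (S i + lam' i - s i) - (S j + lam' j - s j) else 0)) :=
    fun i => by ring
  simp only [h3, sum_add_distrib, ← mul_sum, h1, h2]
  have h4 : ∀ X Y Z W E F : ℝ, 0 ≤ (Z + W - X - Y) + 2 * E + 2 * F →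
      -(ρ * (1 / 2 * E) + ρ * (1 / 2 * F)) ≤ (ρ / 4 * Z + ρ / 4 * W) - (ρ / 4 * X + ρ / 4 * Y) := by
    intro X Y Z W E F h
    nlinarith
  apply h4
  simp only [mul_sum, ← sum_add_distrib, ← sum_sub_distrib]
  refine sum_nonneg fun i _ => sum_nonneg fun j _ => ?_
  split_ifs
  -- Polarization on one edge: each product is half the difference of the new and the old square
  -- plus half the square of the increment. The increment is that of `λᵢ + λⱼ` in the first form and
  -- `λ'ᵢ - λ'ⱼ` in the second.
  · nlinarith [sq_nonneg ((lam' i - Λ) + (lam' j - Λ) - (lam i - Λ) - (lam j - Λ)),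
      sq_nonneg (lam' i - lam' j)]
  · simp

end Graph

/-! ## The decrease of the potential in one iteration -/

/-- The difference of the two sides is a sum of squares with nonnegative weights plus `β (x' - y₁)
(y₁ - w)`, where `w` is the point projected to obtain `y₁`. That product is nonnegative by the
variational inequality of the projection, the only place where `x' ≥ 0` enters. The term in `(x₁ -
x) ^ 2` is kept to pay for the linearized coupling. -/
theorem coordinate_decrease {β τ η c x y z g x' z' y₁ x₁ z₁ : ℝ} (hβ : 0 < β) (hτ : 0 < τ)
    (hβτ : 1 < β * τ) (hη : 0 < η) (hx' : 0 ≤ x')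
    (hy₁ : y₁ = max ((1 - 1 / (β * τ)) * y + 1 / (β * τ) * (x - τ * z)) 0)
    (hx₁ : x₁ = x - 1 / β * (c + η * x + 1 / τ * (x - y₁ - τ * z) + g))
    (hz₁ : z₁ = z + 1 / τ * (y₁ - x₁)) :
    (c * x₁ + η / 2 * x₁ ^ 2) - (c * x' + η / 2 * x' ^ 2) + (x₁ - x') * g - z' * (x₁ - y₁)
      ≤ (β / 2 * (x' - x) ^ 2 + (β - 1 / τ) / 2 * (x' - y) ^ 2 + τ / 2 * (z' - z) ^ 2)
        - (β / 2 * (x' - x₁) ^ 2 + (β - 1 / τ) / 2 * (x' - y₁) ^ 2 + τ / 2 * (z' - z₁) ^ 2)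
        - (β - 1 / τ - η) / 2 * (x₁ - x) ^ 2 := by
  set w := (1 - 1 / (β * τ)) * y + 1 / (β * τ) * (x - τ * z) with hw
  have hβw : β * w = (β - 1 / τ) * y + 1 / τ * x - z := by rw [hw]; field_simp; ring
  have hvi : 0 ≤ (x' - y₁) * (β * (y₁ - w)) := by
    rcases le_total w 0 with h | h
    · rw [max_eq_right h] at hy₁
      rw [hy₁]
      exact mul_nonneg (by linarith) (mul_nonneg hβ.le (by linarith))
    · rw [max_eq_left h] at hy₁
      rw [hy₁]; simp
  have hg : g = β * (x - x₁) - (c + η * x + 1 / τ * (x - y₁ - τ * z)) := by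
    rw [hx₁]; field_simp; ring
  have hpos : 0 ≤ β - 1 / τ := by
    rw [sub_nonneg, div_le_iff₀ hτ]; exact hβτ.le
  have hid : ((β / 2 * (x' - x) ^ 2 + (β - 1 / τ) / 2 * (x' - y) ^ 2 + τ / 2 * (z' - z) ^ 2)
        - (β / 2 * (x' - x₁) ^ 2 + (β - 1 / τ) / 2 * (x' - y₁) ^ 2 + τ / 2 * (z' - z₁) ^ 2)
        - (β - 1 / τ - η) / 2 * (x₁ - x) ^ 2)
      - ((c * x₁ + η / 2 * x₁ ^ 2) - (c * x' + η / 2 * x' ^ 2) + (x₁ - x') * g - z' * (x₁ - y₁))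
      = (x' - y₁) * (β * y₁ - β * w) + τ / 2 * (z - z₁ - 1 / τ * (x₁ - x)) ^ 2
        + (β - 1 / τ) / 2 * (y₁ - y) ^ 2 + η / 2 * (x - x') ^ 2 := by
    rw [hβw, hg, hz₁]
    field_simp
    ring
  have h1 : 0 ≤ τ / 2 * (z - z₁ - 1 / τ * (x₁ - x)) ^ 2 := by positivity
  have h2 : 0 ≤ (β - 1 / τ) / 2 * (y₁ - y) ^ 2 := by positivity
  have h3 : 0 ≤ η / 2 * (x - x') ^ 2 := by positivity
  rw [← mul_sub] at hid
  linarith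

/-! ### Primal potential of a single agent. -/

section Local

variable {κ μ ν : Type} [Fintype κ] [Fintype μ] [Fintype ν]

/-- The primal part of the potential of an agent with `d` neighbours, relative to a point `x`
and a multiplier `z`. -/
noncomputable def Agent.potential (a : Agent κ μ) (d : ℝ) (x z : κ → ℝ) (s : LocalState κ μ) : ℝ :=
  ∑ r, (a.β / 2 * (x r - s.x r) ^ 2 + (a.β - 1 / a.τ) / 2 * (x r - s.y r) ^ 2
      + a.τ / 2 * (z r - s.z r) ^ 2)
    - 1 / (4 * a.ρ * d) * ∑ r, ((a.A *ᵥ x) r - (a.A *ᵥ s.x) r) ^ 2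

/-- The regularized objective of an agent. -/
noncomputable def Agent.objective (a : Agent κ μ) (x : κ → ℝ) : ℝ :=
  ∑ r, (a.c r * x r + a.η / 2 * x r ^ 2)

theorem Agent.potential_decrease (a : Agent κ μ) (hβ : 0 < a.β) (hτ : 0 < a.τ)
    (hβτ : 1 < a.β * a.τ) (hρ : 0 < a.ρ) (hη : 0 < a.η) (hη1 : a.η ≤ 1)
    (hν : 0 < Fintype.card ν)
    (hstep : ∀ v : κ → ℝ, 1 / (2 * a.ρ * (Fintype.card ν : ℝ)) * ∑ r, (a.A *ᵥ v) r ^ 2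
      ≤ (a.β - 1 / a.τ - 1) * ∑ r, v r ^ 2)
    (s : LocalState κ μ) (msg msgNext : ν → μ → ℝ) (x z : κ → ℝ) (hx : ∀ r, 0 ≤ x r) :
    a.objective (a.step s msg msgNext).x - a.objective x
        + ∑ r, ((a.A *ᵥ (a.step s msg msgNext).x) r - (a.A *ᵥ x) r)
            * (a.step s msg msgNext).lam r
        - ∑ r, z r * ((a.step s msg msgNext).x r - (a.step s msg msgNext).y r)
      ≤ a.potential (Fintype.card ν) x z s
        - a.potential (Fintype.card ν) x z (a.step s msg msgNext) := by
  set d : ℝ := ((Fintype.card ν : ℕ) : ℝ) with hd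
  have hd0 : 0 < d := Nat.cast_pos.mpr hν
  set s' := a.step s msg msgNext with hs'
  set w : μ → ℝ := a.A *ᵥ s.x - (1 / (a.N : ℝ)) • a.b - s.p + a.ρ • nbrSum s msg with hw
  set g : κ → ℝ := fun r => 1 / (2 * a.ρ * d) * (a.Aᵀ *ᵥ w) r with hg
  have hcoord := fun r => coordinate_decrease (c := a.c r) (x := s.x r) (y := s.y r) (z := s.z r)
    (g := g r) (x' := x r) (z' := z r) (y₁ := s'.y r) (x₁ := s'.x r) (z₁ := s'.z r)
    hβ hτ hβτ hη (hx r) rfl rfl rfl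
  -- The gradient used in the `x`-step is the new `λ` evaluated at the old `A x`; the mismatch is `A
  -- (x - x₁)`.
  have hlam : ∀ r, 1 / (2 * a.ρ * d) * w r
      = s'.lam r + 1 / (2 * a.ρ * d) * ((a.A *ᵥ s.x) r - (a.A *ᵥ s'.x) r) := by
    intro r
    have h1 : s'.lam r = 1 / (2 * d) * (nbrSum s msg r - 1 / a.ρ * s.p r
      + 1 / a.ρ * ((a.A *ᵥ s'.x) r - 1 / (a.N : ℝ) * a.b r)) := rfl
    have h2 : w r = (a.A *ᵥ s.x) r - 1 / (a.N : ℝ) * a.b r - s.p r + a.ρ * nbrSum s msg r := rfl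
    rw [h1, h2]
    field_simp
    ring
  have hgsum : ∑ r, (s'.x r - x r) * g r
      = ∑ r, ((a.A *ᵥ s'.x) r - (a.A *ᵥ x) r) * (1 / (2 * a.ρ * d) * w r) := by
    have h1 : (s'.x - x) ⬝ᵥ (a.Aᵀ *ᵥ w) = (a.A *ᵥ s'.x - a.A *ᵥ x) ⬝ᵥ w := by
      rw [dotProduct_mulVec, vecMul_transpose, mulVec_sub]
    calc ∑ r, (s'.x r - x r) * g r
        = 1 / (2 * a.ρ * d) * ((s'.x - x) ⬝ᵥ (a.Aᵀ *ᵥ w)) := by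
          simp only [dotProduct, mul_sum, hg, Pi.sub_apply]
          exact sum_congr rfl fun r _ => by ring
      _ = _ := by
          rw [h1]
          simp only [dotProduct, mul_sum, Pi.sub_apply]
          exact sum_congr rfl fun r _ => by ring
  -- Polarizing the mismatch produces the negative `A`-term of the potential and one leftover
  -- square, which the step size must dominate.
  have hA : ∑ r, ((a.A *ᵥ s'.x) r - (a.A *ᵥ x) r) * (1 / (2 * a.ρ * d) * w r)
      = ∑ r, ((a.A *ᵥ s'.x) r - (a.A *ᵥ x) r) * s'.lam r
        + (1 / (4 * a.ρ * d) * ∑ r, ((a.A *ᵥ x) r - (a.A *ᵥ s.x) r) ^ 2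
          - 1 / (4 * a.ρ * d) * ∑ r, ((a.A *ᵥ x) r - (a.A *ᵥ s'.x) r) ^ 2
          - 1 / (4 * a.ρ * d) * ∑ r, ((a.A *ᵥ s'.x) r - (a.A *ᵥ s.x) r) ^ 2) := by
    simp only [mul_sum, ← sum_add_distrib, ← sum_sub_distrib, hlam]
    refine sum_congr rfl fun r _ => ?_
    field_simp
    ring
  have hq := hstep (s'.x - s.x)
  simp only [mulVec_sub, Pi.sub_apply] at hq
  -- The `-1` in the step-size bound absorbs `η ≤ 1`, so the estimate holds uniformly in `η`.
  have hq' : 1 / (4 * a.ρ * d) * ∑ r, ((a.A *ᵥ s'.x) r - (a.A *ᵥ s.x) r) ^ 2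
      ≤ ∑ r, (a.β - 1 / a.τ - a.η) / 2 * (s'.x r - s.x r) ^ 2 := by
    have h1 : 1 / (4 * a.ρ * d) = 1 / 2 * (1 / (2 * a.ρ * d)) := by field_simp; norm_num
    rw [h1, ← mul_sum]
    have h2 : 0 ≤ ∑ r, (s'.x r - s.x r) ^ 2 := sum_nonneg fun _ _ => sq_nonneg _
    nlinarith
  have hsum := sum_le_sum fun r (_ : r ∈ univ) => hcoord r
  simp only [sum_sub_distrib, sum_add_distrib] at hsum
  simp only [Agent.potential, Agent.objective, sum_add_distrib]
  linarith

end Local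

/-- Only a weaker form of the condition is needed, with `1 / τ` in place of the larger `β / (β τ -
1)`. -/
theorem StepSizeCondition.quadratic_bound {V κ μ : Type} [Fintype V] [Fintype κ] [Fintype μ]
    [DecidableEq κ] {G : SimpleGraph V} [DecidableRel G.Adj] {A : V → Matrix μ κ ℝ} {ρ : ℝ}
    {β τ : V → ℝ} (h : StepSizeCondition G A ρ β τ) (i : V) (v : κ → ℝ) :
    1 / (2 * ρ * (G.degree i : ℝ)) * ∑ r, (A i *ᵥ v) r ^ 2
      ≤ (β i - 1 / τ i - 1) * ∑ r, v r ^ 2 := by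
  have h1 := (h.posDef i).posSemidef.dotProduct_mulVec_nonneg v
  have h2 : star v ⬝ᵥ (((β i - β i / (β i * τ i - 1) - 1) • (1 : Matrix κ κ ℝ)
      - (1 / (2 * ρ * (G.degree i : ℝ))) • ((A i)ᵀ * A i)) *ᵥ v)
      = (β i - β i / (β i * τ i - 1) - 1) * ∑ r, v r ^ 2
        - 1 / (2 * ρ * (G.degree i : ℝ)) * ∑ r, (A i *ᵥ v) r ^ 2 := by
    rw [sub_mulVec, smul_mulVec, smul_mulVec, one_mulVec, ← mulVec_mulVec, star_trivial,
      dotProduct_sub, dotProduct_smul, dotProduct_smul, dotProduct_mulVec, vecMul_transpose]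
    simp only [dotProduct, smul_eq_mul, sq]
  rw [h2] at h1
  have h3 : 1 / τ i ≤ β i / (β i * τ i - 1) := by
    rw [div_le_div_iff₀ (h.tau_pos i) (by linarith [h.one_lt i])]
    linarith
  have h4 : 0 ≤ ∑ r, v r ^ 2 := sum_nonneg fun _ _ => sq_nonneg _
  nlinarith

/-! ### Potential of the whole network and its decrease. -/

section Network

variable {V κ μ : Type} [Fintype V] [Fintype κ] [Fintype μ]
  (G : SimpleGraph V) [DecidableRel G.Adj]

/-- The dual part of the potential for one coupling constraint. -/
noncomputable def dualPotential (ρ : ℝ) (lam S s : V → ℝ) (Λ : ℝ) : ℝ :=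
  ρ / 4 * ∑ i, ∑ j, (if G.Adj i j then ((lam i - Λ) + (lam j - Λ)) ^ 2 else 0)
    + ρ / 4 * ∑ i, ∑ j, (if G.Adj i j then ((S i - s i) - (S j - s j)) ^ 2 else 0)

theorem dualPotential_nonneg {ρ : ℝ} (hρ : 0 < ρ) (lam S s : V → ℝ) (Λ : ℝ) :
    0 ≤ dualPotential G ρ lam S s Λ := by
  have : ∀ (b : V → V → ℝ), 0 ≤ ∑ i, ∑ j, (if G.Adj i j then b i j ^ 2 else 0) := fun b =>
    sum_nonneg fun i _ => sum_nonneg fun j _ => by split_ifs <;> positivity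
  have h1 := this fun i j => (lam i - Λ) + (lam j - Λ)
  have h2 := this fun i j => (S i - s i) - (S j - s j)
  unfold dualPotential
  positivity

/-- The subtracted `A`-term is dominated by the `β`-term through the step-size bound applied to `x -
s.x`. -/
theorem Agent.potential_nonneg (a : Agent κ μ) {d : ℝ} (hd : 0 < d)
    (hτ : 0 < a.τ) (hβτ : 1 < a.β * a.τ) (hρ : 0 < a.ρ)
    (hstep : ∀ v : κ → ℝ, 1 / (2 * a.ρ * d) * ∑ r, (a.A *ᵥ v) r ^ 2
      ≤ (a.β - 1 / a.τ - 1) * ∑ r, v r ^ 2)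
    (x z : κ → ℝ) (s : LocalState κ μ) : 0 ≤ a.potential d x z s := by
  have hq := hstep (x - s.x)
  simp only [mulVec_sub, Pi.sub_apply] at hq
  have hpos : 0 ≤ a.β - 1 / a.τ := by
    rw [sub_nonneg, div_le_iff₀ hτ]; exact hβτ.le
  have h1 : 1 / (4 * a.ρ * d) = 1 / 2 * (1 / (2 * a.ρ * d)) := by field_simp; norm_num
  have h2 : 0 ≤ ∑ r, (x r - s.x r) ^ 2 := sum_nonneg fun _ _ => sq_nonneg _
  have h3 : 0 ≤ ∑ r, (x r - s.y r) ^ 2 := sum_nonneg fun _ _ => sq_nonneg _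
  have h4 : 0 ≤ ∑ r, (z r - s.z r) ^ 2 := sum_nonneg fun _ _ => sq_nonneg _
  have h5 : 0 < 1 / a.τ := by positivity
  unfold Agent.potential
  rw [h1]
  simp only [sum_add_distrib, ← mul_sum]
  have h6 := mul_nonneg h5.le h2
  have h7 := mul_nonneg hpos h3
  have h8 := mul_nonneg hτ.le h4
  nlinarith

/-- The agents of the problem `min ∑ i, cᵢ ⬝ xᵢ` subject to `∑ i, Aᵢ xᵢ = b`, `x ≥ 0`. -/
noncomputable def coupledAgent (A : V → Matrix μ κ ℝ) (b : μ → ℝ) (c : V → κ → ℝ) (η ρ : ℝ)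
    (β τ : V → ℝ) (i : V) : Agent κ μ where
  A := A i
  b := b
  c := c i
  N := Fintype.card V
  η := η
  ρ := ρ
  β := β i
  τ := τ i

variable (A : V → Matrix μ κ ℝ) (b : μ → ℝ) (c : V → κ → ℝ) (η ρ : ℝ) (β τ : V → ℝ)

/-- The sum of the first dual iterates of an agent. -/
noncomputable def lamSum (agent : V → Agent κ μ) (k : ℕ) (i : V) (r : μ) : ℝ :=
  ∑ t ∈ range (k + 1), (iterates G agent t i).lam r

/-- Eliminates `p`: it is `ρ` times the Laplacian of the accumulated `λ`. Including the index `0` in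
the accumulation is harmless since `λ⁰ = 0`. -/
theorem iterates_p (k : ℕ) (i : V) (r : μ) :
    (iterates G (coupledAgent A b c η ρ β τ) k i).p r
      = ρ * ∑ j, (if G.Adj i j then lamSum G (coupledAgent A b c η ρ β τ) k i r
          - lamSum G (coupledAgent A b c η ρ β τ) k j r else 0) := by
  set agent := coupledAgent A b c η ρ β τ with hagent
  induction k with
  | zero => simp [lamSum, iterates]
  | succ k ih =>
    have h1 : (iterates G agent (k + 1) i).p r = (iterates G agent k i).p r
        + ρ * (∑ j : G.neighborSet i, ((iterates G agent (k + 1) i).lam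
          - (iterates G agent (k + 1) j).lam)) r := rfl
    rw [h1, ih, Finset.sum_apply, ← mul_add]
    simp only [Pi.sub_apply]
    rw [sum_neighborSet G i fun j => (iterates G agent (k + 1) i).lam r
          - (iterates G agent (k + 1) j).lam r, ← sum_add_distrib]
    congr 1
    refine sum_congr rfl fun j _ => ?_
    split_ifs
    · simp only [lamSum, sum_range_succ _ (k + 1)]; ring
    · simp

/-- The `λ`-update solved for the local residual. Subtracting the old signless sum from `2 d λ'ᵢ`
leaves the signless Laplacian of the increment plus the Laplacian of `λ'`, and the latter advances
the accumulated sum from `k` to `k + 1`. -/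
theorem coupling_residual (hρ : 0 < ρ) (hdeg : ∀ i, 0 < G.degree i) (k : ℕ) (i : V) (r : μ) :
    let agent := coupledAgent A b c η ρ β τ
    (A i *ᵥ (iterates G agent (k + 1) i).x) r - 1 / (Fintype.card V : ℝ) * b r
      = ρ * ∑ j, (if G.Adj i j then
            ((iterates G agent (k + 1) i).lam r - (iterates G agent k i).lam r)
            + ((iterates G agent (k + 1) j).lam r - (iterates G agent k j).lam r) else 0)
        + ρ * ∑ j, (if G.Adj i j then
            lamSum G agent (k + 1) i r - lamSum G agent (k + 1) j r else 0) := by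
  intro agent
  set d : ℝ := ((G.degree i : ℕ) : ℝ) with hd
  have hd0 : 0 < d := Nat.cast_pos.mpr (hdeg i)
  have h1 : (iterates G agent (k + 1) i).lam r
      = 1 / (2 * (Fintype.card (G.neighborSet i) : ℝ)) *
        ((∑ j : G.neighborSet i, ((iterates G agent k j).lam + (iterates G agent k i).lam)) r
          - 1 / ρ * (iterates G agent k i).p r
          + 1 / ρ * ((A i *ᵥ (iterates G agent (k + 1) i).x) r
            - 1 / (Fintype.card V : ℝ) * b r)) := rfl
  rw [G.card_neighborSet_eq_degree, ← hd, Finset.sum_apply] at h1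
  simp only [Pi.add_apply] at h1
  rw [sum_neighborSet G i fun j => (iterates G agent k j).lam r + (iterates G agent k i).lam r,
    iterates_p] at h1
  have h2 : (A i *ᵥ (iterates G agent (k + 1) i).x) r - 1 / (Fintype.card V : ℝ) * b r
      = 2 * ρ * (d * (iterates G agent (k + 1) i).lam r)
        - ρ * (∑ j, if G.Adj i j then
            (iterates G agent k j).lam r + (iterates G agent k i).lam r else 0)
        + ρ * (∑ j, if G.Adj i j then lamSum G agent k i r - lamSum G agent k j r else 0) := by
    rw [h1]; field_simp; ring
  have h3 : d * (iterates G agent (k + 1) i).lam r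
      = ∑ j, if G.Adj i j then (iterates G agent (k + 1) i).lam r else 0 := by
    rw [hd, SimpleGraph.degree_eq_sum_if_adj, sum_mul]
    exact sum_congr rfl fun j _ => by split_ifs <;> simp
  rw [h2, h3]
  simp only [mul_sum, ← sum_add_distrib, ← sum_sub_distrib]
  refine sum_congr rfl fun j _ => ?_
  split_ifs
  · simp only [lamSum, sum_range_succ _ (k + 1)]; ring
  · simp

/-- The potential of the network. -/
noncomputable def networkPotential (R : Matrix V V ℝ) (x z : V → κ → ℝ) (Λ : μ → ℝ)
    (s : V → LocalState κ μ) (S : V → μ → ℝ) : ℝ :=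
  ∑ i, (coupledAgent A b c 0 ρ β τ i).potential (G.degree i) (x i) (z i) (s i)
    + ∑ r, dualPotential G ρ (fun i => (s i).lam r) (fun i => S i r)
        (R *ᵥ fun i => 1 / ρ * ((A i *ᵥ x i) r - 1 / (Fintype.card V : ℝ) * b r)) (Λ r)

variable {A b c η ρ β τ}

theorem networkPotential_decrease [DecidableEq κ] (hstep : StepSizeCondition G A ρ β τ)
    (hdeg : ∀ i, 0 < G.degree i) (hV : 0 < Fintype.card V) {R : Matrix V V ℝ}
    (hR : ∀ v : V → ℝ, ∑ i, v i = 0 → ∀ i,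
      ∑ j, (if G.Adj i j then (R *ᵥ v) i - (R *ᵥ v) j else 0) = v i)
    (hη : 0 < η) (hη1 : η ≤ 1) (x z : V → κ → ℝ) (Λ : μ → ℝ) (hx : ∀ i r, 0 ≤ x i r)
    (hAx : ∀ r, ∑ i, (A i *ᵥ x i) r = b r) (k : ℕ) :
    let agent := coupledAgent A b c η ρ β τ
    ∑ i, ((agent i).objective (iterates G agent (k + 1) i).x - (agent i).objective (x i))
        + ∑ r, Λ r * (∑ i, (A i *ᵥ (iterates G agent (k + 1) i).x) r - b r)
        - ∑ i, ∑ r, z i r * ((iterates G agent (k + 1) i).x r - (iterates G agent (k + 1) i).y r)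
      ≤ networkPotential G A b c ρ β τ R x z Λ (iterates G agent k) (lamSum G agent k)
        - networkPotential G A b c ρ β τ R x z Λ (iterates G agent (k + 1))
            (lamSum G agent (k + 1)) := by
  intro agent
  set s := iterates G agent k with hs
  set s' := iterates G agent (k + 1) with hs'
  have hloc : ∀ i, (agent i).objective (s' i).x - (agent i).objective (x i)
        + ∑ r, ((A i *ᵥ (s' i).x) r - (A i *ᵥ x i) r) * (s' i).lam r
        - ∑ r, z i r * ((s' i).x r - (s' i).y r)
      ≤ (coupledAgent A b c 0 ρ β τ i).potential (G.degree i) (x i) (z i) (s i)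
        - (coupledAgent A b c 0 ρ β τ i).potential (G.degree i) (x i) (z i) (s' i) := by
    intro i
    have hq := hstep.quadratic_bound i
    rw [← G.card_neighborSet_eq_degree] at hq ⊢
    exact (agent i).potential_decrease (ν := G.neighborSet i) (hstep.beta_pos i)
      (hstep.tau_pos i) (hstep.one_lt i) hstep.rho_pos hη hη1
      (by rw [G.card_neighborSet_eq_degree]; exact hdeg i) hq (s i) _ _ (x i) (z i) (hx i)
  have hdual : ∀ r, -∑ i, ((s' i).lam r - Λ r) * ((A i *ᵥ (s' i).x) r - (A i *ᵥ x i) r)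
      ≤ dualPotential G ρ (fun i => (s i).lam r) (fun i => lamSum G agent k i r)
          (R *ᵥ fun i => 1 / ρ * ((A i *ᵥ x i) r - 1 / (Fintype.card V : ℝ) * b r)) (Λ r)
        - dualPotential G ρ (fun i => (s' i).lam r) (fun i => lamSum G agent (k + 1) i r)
          (R *ᵥ fun i => 1 / ρ * ((A i *ᵥ x i) r - 1 / (Fintype.card V : ℝ) * b r)) (Λ r) := by
    intro r
    set σ := R *ᵥ fun i => 1 / ρ * ((A i *ᵥ x i) r - 1 / (Fintype.card V : ℝ) * b r) with hσ
    have hρ := hstep.rho_pos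
    -- `σ` is the accumulated dual vector that would reproduce the local residuals of the feasible
    -- point `x`. These sum to zero over the agents by feasibility, so the right inverse of the
    -- Laplacian applies.
    have hσ' : ∀ i, ρ * ∑ j, (if G.Adj i j then σ i - σ j else 0)
        = (A i *ᵥ x i) r - 1 / (Fintype.card V : ℝ) * b r := by
      intro i
      rw [hR _ ?_ i]
      · field_simp
      · rw [← mul_sum, sum_sub_distrib, hAx]
        have : (Fintype.card V : ℝ) ≠ 0 := by exact_mod_cast hV.ne'
        simp [this]
    have hS : ∀ i, lamSum G agent (k + 1) i r = lamSum G agent k i r + (s' i).lam r := by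
      intro i
      simp only [lamSum, sum_range_succ _ (k + 1)]; rfl
    have hres : ∀ i, (A i *ᵥ (s' i).x) r - (A i *ᵥ x i) r
        = ρ * ∑ j, (if G.Adj i j then ((s' i).lam r - (s i).lam r)
              + ((s' j).lam r - (s j).lam r) else 0)
          + ρ * ∑ j, (if G.Adj i j then (lamSum G agent k i r + (s' i).lam r - σ i)
              - (lamSum G agent k j r + (s' j).lam r - σ j) else 0) := by
      intro i
      have h1 := coupling_residual G A b c η ρ β τ hρ hdeg k i r
      have h2 := hσ' i
      simp only at h1
      have h3 : ρ * ∑ j, (if G.Adj i j then (lamSum G agent k i r + (s' i).lam r - σ i)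
              - (lamSum G agent k j r + (s' j).lam r - σ j) else 0)
          = ρ * ∑ j, (if G.Adj i j then lamSum G agent (k + 1) i r
              - lamSum G agent (k + 1) j r else 0)
            - ρ * ∑ j, (if G.Adj i j then σ i - σ j else 0) := by
        rw [← mul_sub, ← sum_sub_distrib]
        congr 1
        refine sum_congr rfl fun j _ => ?_
        split_ifs
        · rw [hS, hS]; ring
        · simp
      rw [h3, h2]
      linarith
    have h := dual_decrease G hρ (fun i => (s i).lam r) (fun i => (s' i).lam r)
      (fun i => lamSum G agent k i r) σ (Λ r)
    simp only [← hres] at h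
    simp only [← hS] at h
    exact h
  have h1 := sum_le_sum fun i (_ : i ∈ univ) => hloc i
  have h2 := sum_le_sum fun r (_ : r ∈ univ) => hdual r
  -- The iterates `λ'` cancel between the primal and the dual estimate; only the common test
  -- multiplier `Λ` remains.
  have h3 : ∑ i, ∑ r, ((A i *ᵥ (s' i).x) r - (A i *ᵥ x i) r) * (s' i).lam r
      + ∑ r, -∑ i, ((s' i).lam r - Λ r) * ((A i *ᵥ (s' i).x) r - (A i *ᵥ x i) r)
      = ∑ r, Λ r * (∑ i, (A i *ᵥ (s' i).x) r - b r) := by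
    rw [sum_comm, ← sum_add_distrib]
    refine sum_congr rfl fun r _ => ?_
    rw [← hAx, ← sum_sub_distrib, mul_sum, ← sub_eq_add_neg, ← sum_sub_distrib]
    exact sum_congr rfl fun i _ => by ring
  unfold networkPotential
  simp only [sum_sub_distrib, sum_add_distrib] at h1 h2 ⊢
  linarith

end Network

/-! ### The ergodic bound for the averaged iterates. -/

section Network

variable {V κ μ : Type} [Fintype V] [Fintype κ] [Fintype μ]
  (G : SimpleGraph V) [DecidableRel G.Adj]

/-- The matrix of the coupling constraint, acting on the stacked variable. -/
def stackedMatrix (A : V → Matrix μ κ ℝ) : Matrix μ (V × κ) ℝ := Matrix.of fun r v => A v.1 r v.2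

omit [Fintype μ] in
theorem stackedMatrix_mulVec (A : V → Matrix μ κ ℝ) (x : V × κ → ℝ) (r : μ) :
    (stackedMatrix A *ᵥ x) r = ∑ i, (A i *ᵥ fun a => x (i, a)) r := by
  simp [stackedMatrix, mulVec, dotProduct, Fintype.sum_prod_type]

/-- The regularized objective. -/
noncomputable def regCost {σ : Type*} [Fintype σ] (c : σ → ℝ) (η : ℝ) (x : σ → ℝ) : ℝ :=
  ∑ v, (c v * x v + η / 2 * x v ^ 2)

/-- Jensen's inequality, reduced by Cauchy–Schwarz to the square of a sum in each coordinate. -/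
theorem regCost_average_le {σ : Type*} [Fintype σ] (c : σ → ℝ) {η : ℝ} (hη : 0 < η)
    (x : ℕ → σ → ℝ) {k : ℕ} (hk : 0 < k) :
    (k : ℝ) * regCost c η (fun v => 1 / (k : ℝ) * ∑ t ∈ range k, x t v)
      ≤ ∑ t ∈ range k, regCost c η (x t) := by
  have hk' : (0 : ℝ) < k := Nat.cast_pos.mpr hk
  unfold regCost
  rw [sum_comm, mul_sum]
  refine sum_le_sum fun v _ => ?_
  rw [sum_add_distrib, ← mul_sum, ← mul_sum]
  have h := sq_sum_le_card_mul_sum_sq (s := range k) (f := fun t => x t v)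
  rw [card_range] at h
  have h1 : (k : ℝ) * (c v * (1 / (k : ℝ) * ∑ t ∈ range k, x t v)
      + η / 2 * (1 / (k : ℝ) * ∑ t ∈ range k, x t v) ^ 2)
      = c v * ∑ t ∈ range k, x t v + η / 2 * ((∑ t ∈ range k, x t v) ^ 2 / k) := by
    field_simp
  rw [h1]
  have h2 : (∑ t ∈ range k, x t v) ^ 2 / k ≤ ∑ t ∈ range k, x t v ^ 2 := by
    rw [div_le_iff₀ hk']; linarith
  have := mul_le_mul_of_nonneg_left h2 (half_pos hη).le
  linarith

/-- Continuity on a compact box. Uniformity in `z` and `Λ` is essential, since they are later chosen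
depending on `k` and `η`. The potential does not involve the costs, so they may be set to `0` here.
-/
theorem exists_bound_networkPotential (A : V → Matrix μ κ ℝ) (b : μ → ℝ) (ρ : ℝ) (β τ : V → ℝ)
    (R : Matrix V V ℝ) (P : ℝ) :
    ∃ C : ℝ, ∀ (x z : V → κ → ℝ) (Λ : μ → ℝ), (∀ i r, |x i r| ≤ 1) → (∀ i r, |z i r| ≤ P) →
      (∀ r, |Λ r| ≤ P) →
      networkPotential G A b (fun _ _ => 0) ρ β τ R x z Λ (fun _ => ⟨0, 0, 0, 0, 0⟩) 0 ≤ C := by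
  let F : (V → κ → ℝ) × (V → κ → ℝ) × (μ → ℝ) → ℝ := fun w =>
    networkPotential G A b (fun _ _ => 0) ρ β τ R w.1 w.2.1 w.2.2 (fun _ => ⟨0, 0, 0, 0, 0⟩) 0
  have hF : Continuous F := by
    simp only [F, networkPotential, dualPotential, Agent.potential, mulVec, dotProduct]
    refine Continuous.add (by fun_prop) (continuous_finsetSum _ fun r _ => Continuous.add ?_ ?_)
    all_goals
      refine Continuous.mul continuous_const (continuous_finsetSum _ fun i _ =>
        continuous_finsetSum _ fun j _ => ?_)
      split_ifs
      · fun_prop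
      · exact continuous_const
  have hK : IsCompact ((Set.Icc (fun _ _ => -1) (fun _ _ => 1) : Set (V → κ → ℝ)) ×ˢ
      ((Set.Icc (fun _ _ => -P) (fun _ _ => P) : Set (V → κ → ℝ)) ×ˢ
        (Set.Icc (fun _ => -P) (fun _ => P) : Set (μ → ℝ)))) :=
    isCompact_Icc.prod (isCompact_Icc.prod isCompact_Icc)
  obtain ⟨C, hC⟩ := (hK.image hF).bddAbove
  refine ⟨C, fun x z Λ hx hz hΛ => hC ⟨(x, z, Λ), ⟨?_, ?_, ?_⟩, rfl⟩⟩
  · exact ⟨fun i r => (abs_le.mp (hx i r)).1, fun i r => (abs_le.mp (hx i r)).2⟩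
  · exact ⟨fun i r => (abs_le.mp (hz i r)).1, fun i r => (abs_le.mp (hz i r)).2⟩
  · exact ⟨fun r => (abs_le.mp (hΛ r)).1, fun r => (abs_le.mp (hΛ r)).2⟩

variable {G}

/-- The ergodic `O(1/k)` bound, with a constant independent of the regularization. -/
theorem ergodic_bound [DecidableEq κ] [Nontrivial V] (hG : G.Connected) {A : V → Matrix μ κ ℝ}
    (b : μ → ℝ) (c : V → κ → ℝ) {ρ : ℝ} {β τ : V → ℝ} (hstep : StepSizeCondition G A ρ β τ)
    {P : ℝ} (hP : 0 ≤ P) :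
    ∃ C : ℝ, 0 ≤ C ∧ ∀ η : ℝ, 0 < η → η ≤ 1 → ∀ k : ℕ, 0 < k →
      ∃ y : V × κ → ℝ, (∀ v, 0 ≤ y v) ∧ ∀ x : V × κ → ℝ, (∀ v, 0 ≤ x v) → (∀ v, x v ≤ 1) →
        stackedMatrix A *ᵥ x = b →
        regCost (fun v => c v.1 v.2) η (ergodicAverage G (coupledAgent A b c η ρ β τ) k)
          - regCost (fun v => c v.1 v.2) η x
          + P * (∑ r, |(stackedMatrix A *ᵥ ergodicAverage G (coupledAgent A b c η ρ β τ) k) r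
                - b r|
              + ∑ v, |ergodicAverage G (coupledAgent A b c η ρ β τ) k v - y v|)
        ≤ C / k := by
  have hdeg : ∀ i, 0 < G.degree i := fun i => hG.preconnected.degree_pos_of_nontrivial i
  obtain ⟨R, hR⟩ := exists_laplacian_rightInverse G hG
  obtain ⟨C, hC⟩ := exists_bound_networkPotential G A b ρ β τ R P
  refine ⟨max C 0, le_max_right _ _, fun η hη hη1 k hk => ?_⟩
  have hk' : (0 : ℝ) < k := Nat.cast_pos.mpr hk
  set agent := coupledAgent A b c η ρ β τ with hagent
  -- Shifted by one: the decrease from `t` to `t + 1` controls iterate `t + 1`, and the average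
  -- starts at iterate `1`.
  set X : ℕ → V × κ → ℝ := fun t v => (iterates G agent (t + 1) v.1).x v.2 with hX
  set Y : ℕ → V × κ → ℝ := fun t v => (iterates G agent (t + 1) v.1).y v.2 with hY
  have havg : ergodicAverage G agent k = fun v => 1 / (k : ℝ) * ∑ t ∈ range k, X t v := by
    funext v
    simp only [ergodicAverage, hX]
    rw [show Icc 1 k = Ico 1 (k + 1) from by ext; simp, sum_Ico_eq_sum_range]
    simp [add_comm]
  refine ⟨fun v => 1 / (k : ℝ) * ∑ t ∈ range k, Y t v, fun v => ?_, fun x hx0 hx1 hAx => ?_⟩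
  · exact mul_nonneg (by positivity) (sum_nonneg fun t _ => le_max_right _ _)
  rw [havg]
  set xb : V × κ → ℝ := fun v => 1 / (k : ℝ) * ∑ t ∈ range k, X t v with hxb
  set yb : V × κ → ℝ := fun v => 1 / (k : ℝ) * ∑ t ∈ range k, Y t v with hyb
  -- The test multipliers are tuned to the averages, so that the linear terms sum to `k P` times the
  -- ℓ¹ norms of the averaged residuals. They are bounded by `P` whatever the averages are.
  set Λ : μ → ℝ := fun r => P * (SignType.sign ((stackedMatrix A *ᵥ xb) r - b r) : ℝ) with hΛ
  set z : V × κ → ℝ := fun v => -(P * (SignType.sign (xb v - yb v) : ℝ)) with hz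
  have hsign : ∀ u : ℝ, |(SignType.sign u : ℝ)| ≤ 1 := fun u => by
    rcases SignType.sign u with _ | _ | _ <;> simp
  have hmulP : ∀ u : ℝ, |P * (SignType.sign u : ℝ)| ≤ P := fun u => by
    rw [abs_mul, abs_of_nonneg hP]
    exact mul_le_of_le_one_right hP (hsign u)
  have hbound := hC (fun i a => x (i, a)) (fun i a => z (i, a)) Λ
    (fun i a => abs_le.mpr ⟨by linarith [hx0 (i, a)], hx1 (i, a)⟩)
    (fun i a => by simp only [hz, abs_neg]; exact hmulP _) (fun r => hmulP _)
  have hdec := fun t => networkPotential_decrease (c := c) G hstep hdeg Fintype.card_pos hR hη hη1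
    (fun i a => x (i, a)) (fun i a => z (i, a)) Λ (fun i a => hx0 (i, a))
    (fun r => by rw [← stackedMatrix_mulVec, hAx]) t
  simp only [← hagent] at hdec
  set W : ℕ → ℝ := fun t => networkPotential G A b c ρ β τ R (fun i a => x (i, a))
    (fun i a => z (i, a)) Λ (iterates G agent t) (lamSum G agent t) with hW
  have hsum := sum_le_sum fun t (_ : t ∈ range k) => hdec t
  have hWk : 0 ≤ W k := by
    refine add_nonneg (sum_nonneg fun i _ => ?_) (sum_nonneg fun r _ => ?_)
    · exact Agent.potential_nonneg _ (Nat.cast_pos.mpr (hdeg i)) (hstep.tau_pos i)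
        (hstep.one_lt i) hstep.rho_pos (hstep.quadratic_bound i) _ _ _
    · exact dualPotential_nonneg G hstep.rho_pos _ _ _ _
  have hW0 : W 0 ≤ C := by
    have h0 : lamSum G agent 0 = 0 := by
      funext i r; simp [lamSum, iterates]
    simp only [hW, h0]
    exact hbound
  have htel : ∑ t ∈ range k, (W t - W (t + 1)) = W 0 - W k := by
    rw [← neg_inj, ← sum_neg_distrib]
    simp only [neg_sub]
    exact sum_range_sub W k
  have hobj : ∀ t, ∑ i, ((agent i).objective (iterates G agent (t + 1) i).x
      - (agent i).objective fun a => x (i, a))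
      = regCost (fun v => c v.1 v.2) η (X t) - regCost (fun v => c v.1 v.2) η x := by
    intro t
    simp only [sum_sub_distrib, regCost, Fintype.sum_prod_type]
    rfl
  have hzsum : ∀ t, ∑ i, ∑ a, z (i, a) * ((iterates G agent (t + 1) i).x a
      - (iterates G agent (t + 1) i).y a) = ∑ v, z v * (X t v - Y t v) := by
    intro t
    simp only [Fintype.sum_prod_type]
    rfl
  have hAt : ∀ t r, ∑ i, (A i *ᵥ (iterates G agent (t + 1) i).x) r
      = (stackedMatrix A *ᵥ X t) r := fun t r => (stackedMatrix_mulVec A (X t) r).symm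
  have hlhs : ∑ t ∈ range k, (regCost (fun v => c v.1 v.2) η (X t)
        - regCost (fun v => c v.1 v.2) η x
        + ∑ r, Λ r * ((stackedMatrix A *ᵥ X t) r - b r) - ∑ v, z v * (X t v - Y t v)) ≤ C := by
    refine le_trans ?_ (show W 0 - W k ≤ C by linarith)
    rw [← htel]
    refine le_trans (le_of_eq ?_) hsum
    refine sum_congr rfl fun t _ => ?_
    rw [hobj t, hzsum t]
    simp only [hAt]
  have hMavg : ∀ r, (k : ℝ) * ((stackedMatrix A *ᵥ xb) r - b r)
      = ∑ t ∈ range k, ((stackedMatrix A *ᵥ X t) r - b r) := by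
    intro r
    have h1 : xb = (1 / (k : ℝ)) • ∑ t ∈ range k, X t := by
      funext v; simp [hxb, Finset.sum_apply]
    have h2 : stackedMatrix A *ᵥ (∑ t ∈ range k, X t) = ∑ t ∈ range k, stackedMatrix A *ᵥ X t :=
      map_sum (stackedMatrix A).mulVecLin X (range k)
    rw [h1, mulVec_smul, h2, sum_sub_distrib, sum_const, card_range, Pi.smul_apply,
      Finset.sum_apply, smul_eq_mul, nsmul_eq_mul]
    field_simp
  have hxyavg : ∀ v, (k : ℝ) * (xb v - yb v) = ∑ t ∈ range k, (X t v - Y t v) := by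
    intro v
    rw [sum_sub_distrib]
    simp only [hxb, hyb]
    field_simp
  have hΛsum : (k : ℝ) * (P * ∑ r, |(stackedMatrix A *ᵥ xb) r - b r|)
      = ∑ t ∈ range k, ∑ r, Λ r * ((stackedMatrix A *ᵥ X t) r - b r) := by
    rw [sum_comm]
    simp only [mul_sum]
    refine sum_congr rfl fun r _ => ?_
    rw [← mul_sum, ← hMavg, hΛ, ← self_mul_sign]
    ring
  have hzsum' : (k : ℝ) * (P * ∑ v, |xb v - yb v|)
      = -∑ t ∈ range k, ∑ v, z v * (X t v - Y t v) := by
    rw [sum_comm]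
    simp only [mul_sum]
    rw [← sum_neg_distrib]
    refine sum_congr rfl fun v _ => ?_
    rw [← mul_sum, ← hxyavg, hz, ← self_mul_sign]
    ring
  have hreg := regCost_average_le (fun v : V × κ => c v.1 v.2) hη X hk
  rw [le_div_iff₀ hk']
  simp only [sum_add_distrib, sum_sub_distrib] at hlhs
  rw [sum_const, card_range, nsmul_eq_mul] at hlhs
  have := le_max_left C 0
  nlinarith [hreg, hlhs, hΛsum, hzsum']

end Network

/-! ## From the ergodic bound to approximate solutions -/

section LinearProgram

variable {m σ : Type*} [Fintype m] [Fintype σ]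

/-- Hoffman's bound for points that are only close to the nonnegative orthant. -/
theorem hoffman_of_near (M : Matrix m σ ℝ) (d : m → ℝ)
    (hne : ∃ x : σ → ℝ, (∀ v, 0 ≤ x v) ∧ M *ᵥ x = d) :
    ∃ H : ℝ, 0 < H ∧ ∀ u y : σ → ℝ, (∀ v, 0 ≤ y v) →
      ∃ x : σ → ℝ, (∀ v, 0 ≤ x v) ∧ M *ᵥ x = d ∧
        ∑ v, |u v - x v| ≤ H * (∑ r, |(M *ᵥ u) r - d r| + ∑ v, |u v - y v|) := by
  obtain ⟨H, hH, h⟩ := hoffman M d hne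
  set B := ∑ r, ∑ v, |M r v| with hB
  have hB0 : 0 ≤ B := sum_nonneg fun _ _ => sum_nonneg fun _ _ => abs_nonneg _
  refine ⟨1 + H * (1 + B), by positivity, fun u y hy => ?_⟩
  obtain ⟨x, hx, hMx, hxy⟩ := h y hy
  refine ⟨x, hx, hMx, ?_⟩
  set D := ∑ v, |u v - y v| with hD
  set r := ∑ r, |(M *ᵥ u) r - d r| with hr
  have hD0 : 0 ≤ D := sum_nonneg fun _ _ => abs_nonneg _
  have hr0 : 0 ≤ r := sum_nonneg fun _ _ => abs_nonneg _
  have h1 : ∑ r, |(M *ᵥ y) r - d r| ≤ r + B * D := by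
    rw [hr, hB, sum_mul, ← sum_add_distrib]
    refine sum_le_sum fun i _ => ?_
    have h2 : |(M *ᵥ u) i - (M *ᵥ y) i| ≤ (∑ v, |M i v|) * D := by
      rw [← Pi.sub_apply, ← mulVec_sub, sum_mul]
      refine (abs_sum_le_sum_abs _ _).trans (sum_le_sum fun v _ => ?_)
      rw [abs_mul]
      exact mul_le_mul_of_nonneg_left
        (single_le_sum (f := fun v => |u v - y v|) (fun _ _ => abs_nonneg _) (mem_univ v))
        (abs_nonneg _)
    have h3 : (M *ᵥ y) i - d i = ((M *ᵥ u) i - d i) - ((M *ᵥ u) i - (M *ᵥ y) i) := by ring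
    rw [h3]
    exact (abs_sub _ _).trans (by linarith)
  have h4 : ∑ v, |u v - x v| ≤ D + ∑ v, |y v - x v| := by
    rw [hD, ← sum_add_distrib]
    exact sum_le_sum fun v _ => abs_sub_le _ _ _
  have h5 := mul_le_mul_of_nonneg_left h1 hH.le
  have h6 := mul_nonneg hH.le hD0
  have h7 := mul_nonneg (mul_nonneg hH.le hB0) hr0
  nlinarith

theorem abs_dotProduct_sub_le (c u x : σ → ℝ) :
    |c ⬝ᵥ u - c ⬝ᵥ x| ≤ (∑ v, |c v|) * ∑ v, |u v - x v| := by
  rw [← dotProduct_sub, sum_mul]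
  refine (abs_sum_le_sum_abs _ _).trans (sum_le_sum fun v _ => ?_)
  rw [abs_mul]
  exact mul_le_mul_of_nonneg_left
    (single_le_sum (f := fun v => |u v - x v|) (fun _ _ => abs_nonneg _) (mem_univ v))
    (abs_nonneg _)

omit [Fintype m] in
/-- A linear program in standard form with bounded nonempty feasible set has a minimizer. -/
theorem exists_isMinimizer (M : Matrix m σ ℝ) (b : m → ℝ) (c : σ → ℝ)
    (hne : ∃ x : σ → ℝ, (∀ v, 0 ≤ x v) ∧ M *ᵥ x = b)
    (hsimplex : ∀ x : σ → ℝ, (∀ v, 0 ≤ x v) → M *ᵥ x = b → ∑ v, x v = 1) :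
    ∃ x : σ → ℝ, ((∀ v, 0 ≤ x v) ∧ M *ᵥ x = b) ∧
      ∀ y : σ → ℝ, (∀ v, 0 ≤ y v) → M *ᵥ y = b → c ⬝ᵥ x ≤ c ⬝ᵥ y := by
  have hK : IsCompact (stdSimplex ℝ σ ∩ {x | M *ᵥ x = b}) :=
    (isCompact_stdSimplex ℝ σ).inter_right
      (isClosed_eq (continuous_const.matrix_mulVec continuous_id) continuous_const)
  obtain ⟨x₀, h0, h1⟩ := hne
  have hcont : Continuous fun x : σ → ℝ => c ⬝ᵥ x := by
    simp only [dotProduct]; fun_prop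
  obtain ⟨x, hx, hmin⟩ := hK.exists_isMinOn ⟨x₀, ⟨h0, hsimplex x₀ h0 h1⟩, h1⟩
    hcont.continuousOn
  exact ⟨x, ⟨hx.1.1, hx.2⟩, fun y hy hMy => hmin ⟨⟨hy, hsimplex y hy hMy⟩, hMy⟩⟩

theorem regCost_eq (c : σ → ℝ) (η : ℝ) (x : σ → ℝ) :
    regCost c η x = c ⬝ᵥ x + η / 2 * ∑ v, x v ^ 2 := by
  simp only [regCost, dotProduct, sum_add_distrib, mul_sum]

/-- If the penalized regularized objective is small, then the point is an approximate solution of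
the linear program, provided the regularization is at most the accuracy or below an absolute
threshold. -/
theorem approx_of_penalized_bound (M : Matrix m σ ℝ) (b : m → ℝ) (c : σ → ℝ)
    (hne : ∃ x : σ → ℝ, (∀ v, 0 ≤ x v) ∧ M *ᵥ x = b)
    (hsimplex : ∀ x : σ → ℝ, (∀ v, 0 ≤ x v) → M *ᵥ x = b → ∑ v, x v = 1)
    {w : ℝ} (hw : 0 ≤ w) :
    ∃ η₀ : ℝ, 0 < η₀ ∧ ∃ P : ℝ, 0 ≤ P ∧ ∀ C : ℝ, 0 ≤ C → ∀ η ε : ℝ, 0 < η → 0 < ε →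
      (η ≤ ε ∨ η ≤ η₀) → ∀ k : ℝ, 0 < k → (2 * C + 1) / ε ≤ k →
      ∀ u y : σ → ℝ, (∀ v, 0 ≤ y v) →
      (∀ x : σ → ℝ, (∀ v, 0 ≤ x v) → (∀ v, x v ≤ 1) → M *ᵥ x = b →
        regCost c η u - regCost c η x
          + P * (∑ r, |(M *ᵥ u) r - b r| + ∑ v, |u v - y v|) ≤ C / k) →
      ∃ x xs : σ → ℝ, ((∀ v, 0 ≤ x v) ∧ M *ᵥ x = b) ∧ ((∀ v, 0 ≤ xs v) ∧ M *ᵥ xs = b) ∧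
        (∀ x' : σ → ℝ, (∀ v, 0 ≤ x' v) → M *ᵥ x' = b → c ⬝ᵥ xs ≤ c ⬝ᵥ x') ∧
        c ⬝ᵥ u - c ⬝ᵥ xs + w * ∑ v, |u v - x v| ≤ ε := by
  have hle1 : ∀ x : σ → ℝ, (∀ v, 0 ≤ x v) → M *ᵥ x = b → ∀ v, x v ≤ 1 := fun x h0 h1 v => by
    rw [← hsimplex x h0 h1]; exact single_le_sum (fun i _ => h0 i) (mem_univ v)
  obtain ⟨xs, ⟨hxs0, hMxs⟩, hopt⟩ := exists_isMinimizer M b c hne hsimplex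
  obtain ⟨K₁, hK₁, hoff₁⟩ := hoffman_of_near M b hne
  -- The optimal face is again a polyhedron in standard form, with the optimal value as one more
  -- equation.
  obtain ⟨K₂, hK₂, hoff₂⟩ := hoffman_of_near (fromRows M (of fun _ : Unit => c))
    (Sum.elim b fun _ => c ⬝ᵥ xs) ⟨xs, hxs0, by
      rw [fromRows_mulVec, hMxs]; rfl⟩
  set B := ∑ v, |c v| with hB
  have hB0 : 0 ≤ B := sum_nonneg fun _ _ => abs_nonneg _
  -- In `P`, `w * K₁` pays for the distance to the feasible set, `B * K₁` for an infeasible `u`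
  -- undercutting the optimum, and `1` for the residual part of the regularization error. The
  -- threshold makes `η K₂ ≤ 1 / 2`.
  refine ⟨1 / (2 * K₂), by positivity, w * K₁ + B * K₁ + 1, by positivity, ?_⟩
  intro C hC η ε hη hε hηε k hk hkε u y hy hbound
  set r := ∑ r, |(M *ᵥ u) r - b r| + ∑ v, |u v - y v| with hr
  have hr0 : 0 ≤ r :=
    add_nonneg (sum_nonneg fun _ _ => abs_nonneg _) (sum_nonneg fun _ _ => abs_nonneg _)
  obtain ⟨x, hx0, hMx, hux⟩ := hoff₁ u y hy
  refine ⟨x, xs, ⟨hx0, hMx⟩, ⟨hxs0, hMxs⟩, hopt, ?_⟩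
  have hCk : 2 * (C / k) ≤ ε := by
    rw [div_le_iff₀ hε] at hkε
    rw [mul_div_assoc', div_le_iff₀ hk]
    linarith
  have hwux := mul_le_mul_of_nonneg_left hux hw
  have hBr : 0 ≤ B * K₁ * r := by positivity
  set g := c ⬝ᵥ u - c ⬝ᵥ xs with hg
  rcases hηε with h | h
  -- Case `η ≤ ε`: `xs` has squared norm at most `1`, so the regularizer costs at most `ε / 2`, and
  -- `C / k` at most another `ε / 2`.
  · have h1 := hbound xs hxs0 (hle1 xs hxs0 hMxs) hMxs
    rw [regCost_eq, regCost_eq] at h1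
    have h2 : ∑ v, xs v ^ 2 ≤ 1 := by
      rw [← hsimplex xs hxs0 hMxs]
      refine sum_le_sum fun v _ => ?_
      nlinarith [hxs0 v, hle1 xs hxs0 hMxs v]
    have h3 : 0 ≤ ∑ v, u v ^ 2 := sum_nonneg fun _ _ => sq_nonneg _
    have h4 := mul_le_mul_of_nonneg_left h2 (half_pos hη).le
    have h5 := mul_nonneg (half_pos hη).le h3
    have h6 : 0 ≤ C / k := by positivity
    nlinarith
  -- Case `η ≤ η₀`: comparing with a nearby minimizer `x'` bounds the regularization error by `(r +
  -- |g|) / 2`. The `r` part is absorbed by `P` and the `|g|` part by the gap itself; for `g ≥ 0`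
  -- this halves the gap, hence the factor `2` in front of `C`.
  · obtain ⟨x', hx0', hMx', hux'⟩ := hoff₂ u y hy
    rw [fromRows_mulVec] at hMx'
    have hM1 : M *ᵥ x' = b := by
      funext i; exact congrFun hMx' (Sum.inl i)
    have hM2 : c ⬝ᵥ x' = c ⬝ᵥ xs := congrFun hMx' (Sum.inr ())
    have hux'' : ∑ v, |u v - x' v| ≤ K₂ * (r + |g|) := by
      refine hux'.trans (le_of_eq ?_)
      rw [fromRows_mulVec, Fintype.sum_sum_type]
      simp only [Sum.elim_inl, Sum.elim_inr, univ_unique, sum_singleton]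
      rw [hr, show ((of fun _ : Unit => c) *ᵥ u) default = c ⬝ᵥ u from rfl]
      ring
    have h1 := hbound x' hx0' (hle1 x' hx0' hM1) hM1
    rw [regCost_eq, regCost_eq, hM2] at h1
    have h2 : ∑ v, x' v ^ 2 - ∑ v, u v ^ 2 ≤ 2 * ∑ v, |u v - x' v| := by
      rw [← sum_sub_distrib, mul_sum]
      refine sum_le_sum fun v _ => ?_
      have h3 := hle1 x' hx0' hM1 v
      have h4 := hx0' v
      have h5 : x' v * (x' v - u v) ≤ |u v - x' v| := by
        have := neg_abs_le (u v - x' v)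
        have := abs_nonneg (u v - x' v)
        nlinarith
      nlinarith [sq_nonneg (u v - x' v)]
    have h3 := mul_le_mul_of_nonneg_left h2 (half_pos hη).le
    have h4 : η * ∑ v, |u v - x' v| ≤ 1 / 2 * (r + |g|) := by
      have h5 := mul_le_mul_of_nonneg_left hux'' hη.le
      have h6 : η * K₂ ≤ 1 / 2 := by
        rw [le_div_iff₀ (by positivity)] at h; linarith
      have h7 := mul_le_mul_of_nonneg_right h6 (add_nonneg hr0 (abs_nonneg g))
      nlinarith
    -- The gap can be negative at an infeasible `u`, but no further than the cost of repairing
    -- feasibility.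
    have h5 : -(B * K₁ * r) ≤ g := by
      have h6 := (abs_le.mp (abs_dotProduct_sub_le c u x)).1
      have h7 := hopt x hx0 hMx
      have h8 := mul_le_mul_of_nonneg_left hux hB0
      rw [hg]; nlinarith
    have h6 : 0 ≤ C / k := by positivity
    have h7 : 0 ≤ w * K₁ * r := by positivity
    have h9 : (w * K₁ + B * K₁ + 1) * r = w * K₁ * r + B * K₁ * r + r := by ring
    have h10 : η / 2 * (∑ v, x' v ^ 2 - ∑ v, u v ^ 2)
        = η / 2 * ∑ v, x' v ^ 2 - η / 2 * ∑ v, u v ^ 2 := by ring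
    have h11 : η / 2 * (2 * ∑ v, |u v - x' v|) = η * ∑ v, |u v - x' v| := by ring
    rw [← mul_assoc] at hwux
    rw [h9] at h1
    rw [h10, h11] at h3
    rcases le_total 0 g with h8 | h8
    · rw [abs_of_nonneg h8] at h4
      linarith
    · rw [abs_of_nonpos h8] at h4
      linarith

end LinearProgram

/-- The averaged iterates are close to feasible points and nearly optimal. -/
theorem coupled_convergence {V κ μ : Type} [Fintype V] [Fintype κ] [Fintype μ] [DecidableEq κ]
    [Nontrivial V] {G : SimpleGraph V} [DecidableRel G.Adj] (hG : G.Connected)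
    (A : V → Matrix μ κ ℝ) (b : μ → ℝ) (c : V → κ → ℝ)
    (hne : ∃ x : V × κ → ℝ, (∀ v, 0 ≤ x v) ∧ stackedMatrix A *ᵥ x = b)
    (hsimplex : ∀ x : V × κ → ℝ, (∀ v, 0 ≤ x v) → stackedMatrix A *ᵥ x = b → ∑ v, x v = 1)
    {w : ℝ} (hw : 0 ≤ w) :
    ∃ η₀ : ℝ, 0 < η₀ ∧ ∀ (ρ : ℝ) (β τ : V → ℝ), StepSizeCondition G A ρ β τ →
      ∃ K₀ : ℝ, 0 < K₀ ∧ ∀ η : ℝ, 0 < η → η ≤ 1 → ∀ ε : ℝ, 0 < ε → (η ≤ ε ∨ η ≤ η₀) →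
        ∀ k : ℕ, K₀ / ε ≤ (k : ℝ) →
        ∃ x xs : V × κ → ℝ, ((∀ v, 0 ≤ x v) ∧ stackedMatrix A *ᵥ x = b) ∧
          ((∀ v, 0 ≤ xs v) ∧ stackedMatrix A *ᵥ xs = b) ∧
          (∀ x' : V × κ → ℝ, (∀ v, 0 ≤ x' v) → stackedMatrix A *ᵥ x' = b →
            ∑ v, c v.1 v.2 * xs v ≤ ∑ v, c v.1 v.2 * x' v) ∧
          ∑ v, c v.1 v.2 * ergodicAverage G (coupledAgent A b c η ρ β τ) k v
              - ∑ v, c v.1 v.2 * xs v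
            + w * ∑ v, |ergodicAverage G (coupledAgent A b c η ρ β τ) k v - x v| ≤ ε := by
  obtain ⟨η₀, hη₀, P, hP, h⟩ :=
    approx_of_penalized_bound (stackedMatrix A) b (fun v => c v.1 v.2) hne hsimplex hw
  refine ⟨η₀, hη₀, fun ρ β τ hstep => ?_⟩
  obtain ⟨C, hC, hbound⟩ := ergodic_bound hG b c hstep hP
  -- The `+ 1` makes `K₀` positive even if `C = 0`, which forces `k > 0`.
  refine ⟨2 * C + 1, by positivity, fun η hη hη1 ε hε hηε k hk => ?_⟩
  have hk0 : (0 : ℝ) < k := lt_of_lt_of_le (by positivity) hk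
  obtain ⟨y, hy, hy'⟩ := hbound η hη hη1 k (Nat.cast_pos.mp hk0)
  exact h C hC η ε hη hε hηε k hk0 hk _ y hy hy'

/-! ## Projection onto the simplex -/

/-- In Euclidean norm the projection is no farther from `u` than `x` is, and the Euclidean norm is
at most the ℓ¹ norm. Bounding each coordinate separately costs the number of coordinates. -/
theorem IsSimplexProjection.sum_abs_sub_le {σ : Type} [Fintype σ] {u u' x : σ → ℝ}
    (h : IsSimplexProjection u u') (hx : x ∈ stdSimplex ℝ σ) :
    ∑ v, |u v - u' v| ≤ (Fintype.card σ : ℝ) * ∑ v, |u v - x v| := by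
  set D := ∑ v, |u v - x v| with hD
  have hD0 : 0 ≤ D := sum_nonneg fun _ _ => abs_nonneg _
  have h1 : ∑ v, (u v - x v) ^ 2 ≤ D ^ 2 := by
    have h2 : ∀ v, |u v - x v| ≤ D := fun v =>
      single_le_sum (f := fun v => |u v - x v|) (fun _ _ => abs_nonneg _) (mem_univ v)
    calc ∑ v, (u v - x v) ^ 2 ≤ ∑ v, D * |u v - x v| := by
          refine sum_le_sum fun v _ => ?_
          rw [← sq_abs]
          nlinarith [h2 v, abs_nonneg (u v - x v)]
      _ = D ^ 2 := by rw [← mul_sum]; ring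
  have h3 : ∀ v, |u v - u' v| ≤ D := fun v => by
    refine abs_le_of_sq_le_sq ?_ hD0
    exact (single_le_sum (f := fun v => (u v - u' v) ^ 2) (fun _ _ => sq_nonneg _)
      (mem_univ v)).trans ((h.2 x hx).trans h1)
  calc ∑ v, |u v - u' v| ≤ ∑ _v : σ, D := sum_le_sum fun v _ => h3 v
    _ = (Fintype.card σ : ℝ) * D := by simp

theorem euclNorm_le_sum_abs {σ : Type} [Fintype σ] (v : σ → ℝ) : euclNorm v ≤ ∑ i, |v i| := by
  have h0 : 0 ≤ ∑ i, |v i| := sum_nonneg fun _ _ => abs_nonneg _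
  refine Real.sqrt_le_iff.mpr ⟨h0, ?_⟩
  calc ∑ i, v i ^ 2 ≤ ∑ i, (∑ j, |v j|) * |v i| := by
        refine sum_le_sum fun i _ => ?_
        have := single_le_sum (f := fun v' => |v v'|) (fun _ _ => abs_nonneg _) (mem_univ i)
        rw [← sq_abs]
        nlinarith [abs_nonneg (v i)]
    _ = _ := by rw [← mul_sum]; ring

/-! ## The two reformulations -/

/-- Justifies dropping the last row of the marginal system and of the Laplacian: in both cases the
total is already determined. -/
theorem eq_of_eq_notLast {n : ℕ} {f g : Fin n → ℝ} (h : ∀ s : Fin (n - 1), f (notLast s) = g (notLast s))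
    (hsum : ∑ i, f i = ∑ i, g i) : f = g := by
  obtain _ | m := n
  · exact Subsingleton.elim _ _
  · have h' : ∀ s : Fin m, f s.castSucc = g s.castSucc := fun s => h s
    rw [Fin.sum_univ_castSucc, Fin.sum_univ_castSucc, sum_congr rfl fun s _ => h' s] at hsum
    funext i
    induction i using Fin.lastCases with
    | last => linarith
    | cast s => exact h' s

theorem mulVec_one_apply {n : ℕ} (X : Matrix (Fin n) (Fin n) ℝ) (a : Fin n) :
    (X *ᵥ 1) a = ∑ j, X a j := by
  simp [mulVec, dotProduct]

theorem margBlockT_mulVec_inl {n : ℕ} (i : Fin n) (x : Fin n → ℝ) (a : Fin n) :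
    (margBlockT n i *ᵥ x) (Sum.inl a) = x a := by
  simp [margBlockT, margBlock, mulVec, dotProduct, Matrix.one_apply]

theorem margBlockT_mulVec_inr {n : ℕ} (i : Fin n) (x : Fin n → ℝ) (s : Fin (n - 1)) :
    (margBlockT n i *ᵥ x) (Sum.inr s) = if notLast s = i then ∑ a, x a else 0 := by
  simp only [margBlockT, margBlock, mulVec, dotProduct, submatrix_apply, Sum.map_inr, id_eq,
    fromRows_apply_inr, of_apply]
  split_ifs <;> simp

theorem margMatrixT_mulVec_inl {n : ℕ} (y : Fin n × Fin n → ℝ) (a : Fin n) :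
    (margMatrixT n *ᵥ y) (Sum.inl a) = ∑ j, y (a, j) := by
  have : (margMatrixT n *ᵥ y) (Sum.inl a)
      = ∑ j, (margBlockT n j *ᵥ fun a => y (a, j)) (Sum.inl a) := by
    simp only [margMatrixT, mulVec, dotProduct, of_apply, Fintype.sum_prod_type]
    exact sum_comm
  simp only [this, margBlockT_mulVec_inl]

theorem margMatrixT_mulVec_inr {n : ℕ} (y : Fin n × Fin n → ℝ) (s : Fin (n - 1)) :
    (margMatrixT n *ᵥ y) (Sum.inr s) = ∑ a, y (a, notLast s) := by
  have : (margMatrixT n *ᵥ y) (Sum.inr s)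
      = ∑ j, (margBlockT n j *ᵥ fun a => y (a, j)) (Sum.inr s) := by
    simp only [margMatrixT, mulVec, dotProduct, of_apply, Fintype.sum_prod_type]
    exact sum_comm
  simp only [this, margBlockT_mulVec_inr]
  simp

theorem margRhs_eq_iff {n : ℕ} {p q : Fin n → ℝ} (hp : p ∈ stdSimplex ℝ (Fin n))
    (hq : q ∈ stdSimplex ℝ (Fin n)) (X : Matrix (Fin n) (Fin n) ℝ) :
    ((∀ a, ∑ j, X a j = p a) ∧ ∀ s : Fin (n - 1), ∑ a, X a (notLast s) = q (notLast s))
      ↔ X *ᵥ 1 = p ∧ Xᵀ *ᵥ 1 = q := by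
  constructor
  · rintro ⟨h1, h2⟩
    refine ⟨funext fun a => (mulVec_one_apply X a).trans (h1 a), eq_of_eq_notLast (fun s => ?_) ?_⟩
    · rw [mulVec_one_apply]; exact h2 s
    · simp only [mulVec_one_apply, transpose_apply]
      rw [sum_comm]
      simp only [h1, hp.2, hq.2]
  · rintro ⟨h1, h2⟩
    refine ⟨fun a => by rw [← h1, mulVec_one_apply], fun s => ?_⟩
    rw [← h2, mulVec_one_apply]; rfl

theorem stacked_margBlockT_eq_iff {n : ℕ} {p q : Fin n → ℝ} (hp : p ∈ stdSimplex ℝ (Fin n))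
    (hq : q ∈ stdSimplex ℝ (Fin n)) (x : Fin n × Fin n → ℝ) :
    ((∀ v, 0 ≤ x v) ∧ stackedMatrix (margBlockT n) *ᵥ x = margRhs p q)
      ↔ IsOTFeasible p q (of fun a j => x (j, a)) := by
  unfold IsOTFeasible
  rw [← margRhs_eq_iff hp hq]
  have h1 : (∀ v, 0 ≤ x v) ↔ ∀ a j, 0 ≤ (of fun a j => x (j, a) : Matrix _ _ ℝ) a j :=
    ⟨fun h a j => h (j, a), fun h v => h v.2 v.1⟩
  rw [h1, funext_iff, Sum.forall]
  simp only [stackedMatrix_mulVec, margBlockT_mulVec_inl, margBlockT_mulVec_inr, margRhs,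
    Sum.elim_inl, Sum.elim_inr, of_apply, sum_ite_eq, mem_univ, if_true]

theorem euclNorm_marginal_sub_le {n : ℕ} (X Y : Matrix (Fin n) (Fin n) ℝ) :
    euclNorm (X *ᵥ 1 - Y *ᵥ 1) ≤ ∑ a, ∑ j, |X a j - Y a j| := by
  refine (euclNorm_le_sum_abs _).trans (sum_le_sum fun a _ => ?_)
  rw [Pi.sub_apply, mulVec_one_apply, mulVec_one_apply, ← sum_sub_distrib]
  exact abs_sum_le_sum_abs _ _

theorem euclNorm_marginal_transpose_sub_le {n : ℕ} (X Y : Matrix (Fin n) (Fin n) ℝ) :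
    euclNorm (Xᵀ *ᵥ 1 - Yᵀ *ᵥ 1) ≤ ∑ a, ∑ j, |X a j - Y a j| := by
  rw [sum_comm]
  exact euclNorm_marginal_sub_le Xᵀ Yᵀ

theorem IsSimplexProjection.bounds {σ : Type} [Fintype σ] {u u' x : σ → ℝ}
    (h : IsSimplexProjection u u') (hx : x ∈ stdSimplex ℝ σ) (c : σ → ℝ) :
    ∑ v, c v * u' v ≤ ∑ v, c v * u v
        + (∑ v, |c v|) * ((Fintype.card σ : ℝ) * ∑ v, |u v - x v|) ∧
      ∑ v, |u' v - x v| ≤ ((Fintype.card σ : ℝ) + 1) * ∑ v, |u v - x v| := by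
  have h1 := h.sum_abs_sub_le hx
  have hB : 0 ≤ ∑ v, |c v| := sum_nonneg fun _ _ => abs_nonneg _
  constructor
  · have h2 := (abs_le.mp (abs_dotProduct_sub_le c u u')).1
    simp only [dotProduct] at h2
    have h3 := mul_le_mul_of_nonneg_left h1 hB
    linarith
  · have h2 : ∑ v, |u' v - x v| ≤ ∑ v, |u v - u' v| + ∑ v, |u v - x v| := by
      rw [← sum_add_distrib]
      refine sum_le_sum fun v _ => ?_
      rw [abs_sub_comm (u v)]
      exact abs_sub_le _ _ _
    linarith

theorem cost_swap {n : ℕ} (C : Matrix (Fin n) (Fin n) ℝ) (x : Fin n × Fin n → ℝ) :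
    cost C (of fun a j => x (j, a)) = ∑ v : Fin n × Fin n, C v.2 v.1 * x v := by
  simp only [cost, of_apply, Fintype.sum_prod_type]
  exact sum_comm

theorem ot_convergence (n : ℕ) (hn : 2 ≤ n) (G : SimpleGraph (Fin n)) [DecidableRel G.Adj]
    (hG : G.Connected) (p q : Fin n → ℝ) (hp : p ∈ stdSimplex ℝ (Fin n))
    (hq : q ∈ stdSimplex ℝ (Fin n)) (C : Matrix (Fin n) (Fin n) ℝ) :
    ∃ η₀ : ℝ, 0 < η₀ ∧
      ∀ (ρ : ℝ) (β τ : Fin n → ℝ), StepSizeCondition G (margBlockT n) ρ β τ →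
      ∃ K₀ : ℝ, 0 < K₀ ∧
        ∀ η : ℝ, 0 < η → η ≤ 1 → ∀ ε : ℝ, 0 < ε → (η ≤ ε ∨ η ≤ η₀) →
        ∀ k : ℕ, K₀ / ε ≤ (k : ℝ) →
        ∀ xhat : Fin n × Fin n → ℝ,
          IsSimplexProjection
            (ergodicAverage G
              (fun i => otAgent p q i (fun a => C a i) η ρ (β i) (τ i)) k) xhat →
          IsApproxOT C p q ε (Matrix.of fun a j => xhat (j, a)) := by
  have : Nontrivial (Fin n) := Fin.nontrivial_iff_two_le.mpr hn
  set c : Fin n → Fin n → ℝ := fun i a => C a i with hc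
  set B : ℝ := ∑ v : Fin n × Fin n, |c v.1 v.2| with hB
  set d : ℝ := ((Fintype.card (Fin n × Fin n) : ℕ) : ℝ) with hd
  have hB0 : 0 ≤ B := sum_nonneg fun _ _ => abs_nonneg _
  have hd0 : 0 ≤ d := Nat.cast_nonneg _
  have hfeas := stacked_margBlockT_eq_iff hp hq
  have htotal : ∀ x : Fin n × Fin n → ℝ, (∀ v, 0 ≤ x v) →
      stackedMatrix (margBlockT n) *ᵥ x = margRhs p q → ∑ v, x v = 1 := by
    intro x hx hMx
    have h1 := ((hfeas x).mp ⟨hx, hMx⟩).2.1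
    rw [← hp.2, ← h1]
    simp only [mulVec_one_apply, of_apply, Fintype.sum_prod_type]
    exact sum_comm
  have hne : ∃ x : Fin n × Fin n → ℝ, (∀ v, 0 ≤ x v) ∧
      stackedMatrix (margBlockT n) *ᵥ x = margRhs p q := by
    -- The independent coupling. The index pair is (column, row), since agents hold columns.
    refine ⟨fun v => p v.2 * q v.1, (hfeas _).mpr ⟨fun a j => mul_nonneg (hp.1 a) (hq.1 j), ?_, ?_⟩⟩
    · funext a
      simp [mulVec_one_apply, ← mul_sum, hq.2]
    · funext a
      simp [mulVec_one_apply, ← sum_mul, hp.2]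
  -- The weight `B * d` pays for the change of cost under the projection. Each of the two marginal
  -- errors is at most `d + 1` times the distance from the average to `x`.
  obtain ⟨η₀, hη₀, h⟩ := coupled_convergence hG (margBlockT n) (margRhs p q) c hne htotal
    (w := B * d + 2 * (d + 1)) (by positivity)
  refine ⟨η₀, hη₀, fun ρ β τ hstep => ?_⟩
  obtain ⟨K₀, hK₀, h⟩ := h ρ β τ hstep
  refine ⟨K₀, hK₀, fun η hη hη1 ε hε hηε k hk xhat hproj => ?_⟩
  have hagent : (fun i => otAgent p q i (fun a => C a i) η ρ (β i) (τ i))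
      = coupledAgent (margBlockT n) (margRhs p q) c η ρ β τ := by
    funext i
    simp [otAgent, coupledAgent, hc]
  rw [hagent] at hproj
  obtain ⟨x, xs, hx, hxs, hopt, hle⟩ := h η hη hη1 ε hε hηε k hk
  set u := ergodicAverage G (coupledAgent (margBlockT n) (margRhs p q) c η ρ β τ) k with hu
  have hxF := (hfeas x).mp hx
  have hb := hproj.bounds ⟨hx.1, htotal x hx.1 hx.2⟩ (fun v => c v.1 v.2)
  refine ⟨fun a j => hproj.1.1 _, of fun a j => xs (j, a), ⟨(hfeas xs).mp hxs, fun Y hY => ?_⟩, ?_⟩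
  · have hY' := (hfeas fun v => Y v.2 v.1).mpr hY
    have := hopt _ hY'.1 hY'.2
    rw [cost_swap]
    refine this.trans (le_of_eq (cost_swap C fun v => Y v.2 v.1).symm)
  · have h1 := euclNorm_marginal_sub_le (of fun a j => xhat (j, a)) (of fun a j => x (j, a))
    have h2 := euclNorm_marginal_transpose_sub_le (of fun a j => xhat (j, a))
      (of fun a j => x (j, a))
    rw [hxF.2.1] at h1
    rw [hxF.2.2] at h2
    have h3 : ∑ a, ∑ j, |(of fun a j => xhat (j, a) : Matrix (Fin n) (Fin n) ℝ) a j
        - (of fun a j => x (j, a) : Matrix (Fin n) (Fin n) ℝ) a j| = ∑ v, |xhat v - x v| := by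
      simp only [of_apply, Fintype.sum_prod_type]
      exact sum_comm
    rw [h3] at h1 h2
    rw [cost_swap, cost_swap]
    obtain ⟨hb1, hb2⟩ := hb
    simp only [hc] at hb1 hle
    simp only [hB, hc] at hle
    rw [← hd] at hb1 hb2
    linarith

/-! ### Equitable optimal transport -/

theorem lapMatrix_mulVec_eq_zero_iff {N : ℕ} (G : SimpleGraph (Fin N)) [DecidableRel G.Adj]
    (hG : G.Connected) (v : Fin N → ℝ) :
    (∀ s : Fin (N - 1), (G.lapMatrix ℝ *ᵥ v) (notLast s) = 0) ↔ ∀ k l, v k = v l := by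
  have hsum : ∑ i, (G.lapMatrix ℝ *ᵥ v) i = ∑ _i : Fin N, (0 : ℝ) := by
    have h := G.lapMatrix_mulVec_const_eq_zero (R := ℝ)
    have : ∑ i, (G.lapMatrix ℝ *ᵥ v) i = (fun _ => (1 : ℝ)) ⬝ᵥ (G.lapMatrix ℝ *ᵥ v) := by
      simp [dotProduct]
    rw [this, dotProduct_mulVec, ← mulVec_transpose, (G.isSymm_lapMatrix (R := ℝ)).eq, h,
      zero_dotProduct, sum_const_zero]
  constructor
  · intro h k l
    have h0 : G.lapMatrix ℝ *ᵥ v = fun _ => 0 := eq_of_eq_notLast h hsum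
    exact (G.lapMatrix_mulVec_eq_zero_iff_forall_reachable).mp h0 k l (hG.preconnected k l)
  · intro h s
    have h0 := (G.lapMatrix_mulVec_eq_zero_iff_forall_reachable (x := v)).mpr fun k l _ => h k l
    rw [h0]; rfl

theorem equityBlock_mulVec {n N : ℕ} (G : SimpleGraph (Fin N)) [DecidableRel G.Adj]
    (C : Matrix (Fin n) (Fin n) ℝ) (i : Fin N) (x : Fin n × Fin n → ℝ) (s : Fin (N - 1)) :
    (equityBlock G C i *ᵥ x) s
      = G.lapMatrix ℝ (notLast s) i * cost C (of fun a j => x (a, j)) := by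
  simp only [equityBlock, vecMulVec, mulVec, dotProduct, of_apply, vecEntries, cost,
    Fintype.sum_prod_type, mul_sum, mul_assoc]

theorem stacked_eotBlock_eq_iff {n N : ℕ} (G : SimpleGraph (Fin N)) [DecidableRel G.Adj]
    (hG : G.Connected) {p q : Fin n → ℝ} (hp : p ∈ stdSimplex ℝ (Fin n))
    (hq : q ∈ stdSimplex ℝ (Fin n)) (C : Fin N → Matrix (Fin n) (Fin n) ℝ)
    (x : Fin N × (Fin n × Fin n) → ℝ) :
    ((∀ v, 0 ≤ x v) ∧ stackedMatrix (fun i => eotBlock G (C i) i) *ᵥ x = eotRhs N p q)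
      ↔ IsEOTFeasible C p q (fun i => of fun a j => x (i, (a, j))) := by
  unfold IsEOTFeasible
  rw [← margRhs_eq_iff hp hq, ← lapMatrix_mulVec_eq_zero_iff G hG
    (fun k => cost (C k) (of fun a j => x (k, (a, j))))]
  have h1 : (∀ v, 0 ≤ x v)
      ↔ ∀ k a j, 0 ≤ (of fun a j => x (k, (a, j)) : Matrix _ _ ℝ) a j :=
    ⟨fun h k a j => h (k, (a, j)), fun h v => h v.1 v.2.1 v.2.2⟩
  rw [h1, funext_iff, Sum.forall, Sum.forall]
  have h2 : ∀ s, (stackedMatrix (fun i => eotBlock G (C i) i) *ᵥ x) (Sum.inr s)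
      = (G.lapMatrix ℝ *ᵥ fun k => cost (C k) (of fun a j => x (k, (a, j)))) (notLast s) := by
    intro s
    simp only [stackedMatrix_mulVec, eotBlock, fromRows_mulVec, Sum.elim_inr, equityBlock_mulVec]
    rfl
  have h3 : ∀ a, (stackedMatrix (fun i => eotBlock G (C i) i) *ᵥ x) (Sum.inl (Sum.inl a))
      = ∑ j, (∑ k, of fun a j => x (k, (a, j)) : Matrix (Fin n) (Fin n) ℝ) a j := by
    intro a
    simp only [stackedMatrix_mulVec, eotBlock, fromRows_mulVec, Sum.elim_inl,
      margMatrixT_mulVec_inl, Matrix.sum_apply, of_apply]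
    exact sum_comm
  have h4 : ∀ s, (stackedMatrix (fun i => eotBlock G (C i) i) *ᵥ x) (Sum.inl (Sum.inr s))
      = ∑ a, (∑ k, of fun a j => x (k, (a, j)) : Matrix (Fin n) (Fin n) ℝ) a (notLast s) := by
    intro s
    simp only [stackedMatrix_mulVec, eotBlock, fromRows_mulVec, Sum.elim_inl,
      margMatrixT_mulVec_inr, Matrix.sum_apply, of_apply]
    exact sum_comm
  simp only [h2, h3, h4, eotRhs, margRhs, Sum.elim_inl, Sum.elim_inr, Pi.zero_apply]
  tauto

/-- Weights proportional to the inverses of the `v k`, or all mass on an index where `v` vanishes.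
Splitting the independent coupling with such weights makes equitable transport feasible when the
costs are nonnegative. -/
theorem exists_equalizing_weights {N : ℕ} (hN : 0 < N) (v : Fin N → ℝ) (hv : ∀ k, 0 ≤ v k) :
    ∃ t : Fin N → ℝ, (∀ k, 0 ≤ t k) ∧ ∑ k, t k = 1 ∧ ∀ k l, t k * v k = t l * v l := by
  by_cases h : ∃ k, v k = 0
  · obtain ⟨k, hk⟩ := h
    refine ⟨Pi.single k 1, fun l => ?_, by simp, ?_⟩
    · by_cases hl : l = k
      · subst hl; simp
      · simp [hl]
    · have : ∀ l, Pi.single (M := fun _ => ℝ) k 1 l * v l = 0 := fun l => by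
        by_cases hl : l = k
        · subst hl; simp [hk]
        · simp [hl]
      intro l l'
      rw [this, this]
  · push Not at h
    have hpos : ∀ k, 0 < v k := fun k => lt_of_le_of_ne (hv k) (h k).symm
    have : Nonempty (Fin N) := ⟨⟨0, hN⟩⟩
    have hT : 0 < ∑ k, (v k)⁻¹ := sum_pos (fun k _ => inv_pos.mpr (hpos k)) univ_nonempty
    refine ⟨fun k => (v k)⁻¹ / ∑ k, (v k)⁻¹, fun k => ?_, ?_, fun k l => ?_⟩
    · exact div_nonneg (inv_nonneg.mpr (hv k)) hT.le
    · rw [← sum_div, div_self hT.ne']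
    · have h1 := h k
      have h2 := h l
      have h3 := hT.ne'
      rw [div_mul_eq_mul_div, inv_mul_cancel₀ h1, div_mul_eq_mul_div, inv_mul_cancel₀ h2]

theorem cost_eq_sum {n : ℕ} (C : Matrix (Fin n) (Fin n) ℝ) (y : Fin n × Fin n → ℝ) :
    cost C (of fun a j => y (a, j)) = ∑ v : Fin n × Fin n, vecEntries C v * y v := by
  simp only [cost, of_apply, Fintype.sum_prod_type, vecEntries]

theorem sum_cost_eq_sum {n N : ℕ} (C : Fin N → Matrix (Fin n) (Fin n) ℝ)
    (x : Fin N × (Fin n × Fin n) → ℝ) :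
    ∑ k, cost (C k) (of fun a j => x (k, (a, j)))
      = ∑ v : Fin N × (Fin n × Fin n), vecEntries (C v.1) v.2 * x v := by
  rw [Fintype.sum_prod_type]
  exact sum_congr rfl fun k _ => cost_eq_sum (C k) fun v => x (k, v)

/-- The mean absolute deviation of a perturbation of a constant family. -/
theorem mean_abs_deviation_le {N : ℕ} (hN : 1 ≤ N) (f g : Fin N → ℝ) (hg : ∀ k l, g k = g l) :
    1 / (N : ℝ) * ∑ k, |f k - 1 / (N : ℝ) * ∑ l, f l| ≤ 2 * ∑ k, |f k - g k| := by
  have hN0 : (0 : ℝ) < N := by exact_mod_cast hN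
  set E := ∑ k, |f k - g k| with hE
  have hE0 : 0 ≤ E := sum_nonneg fun _ _ => abs_nonneg _
  have h1 : ∀ k, |f k - 1 / (N : ℝ) * ∑ l, f l| ≤ |f k - g k| + 1 / (N : ℝ) * E := by
    intro k
    have h2 : f k - 1 / (N : ℝ) * ∑ l, f l
        = (f k - g k) - 1 / (N : ℝ) * ∑ l, (f l - g l) := by
      rw [sum_sub_distrib, sum_congr rfl fun l _ => hg l k]
      simp only [sum_const, card_univ, Fintype.card_fin, nsmul_eq_mul]
      field_simp
      ring
    rw [h2]
    refine (abs_sub _ _).trans ?_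
    rw [abs_mul, abs_of_pos (by positivity : 0 < 1 / (N : ℝ))]
    have := abs_sum_le_sum_abs (fun l => f l - g l) univ
    gcongr
  have h3 : ∑ k, |f k - 1 / (N : ℝ) * ∑ l, f l| ≤ 2 * E := by
    refine (sum_le_sum fun k _ => h1 k).trans (le_of_eq ?_)
    rw [sum_add_distrib, sum_const, card_univ, Fintype.card_fin, nsmul_eq_mul]
    field_simp
    ring
  have h4 : 1 / (N : ℝ) ≤ 1 := by
    rw [div_le_one hN0]; exact_mod_cast hN
  calc _ ≤ 1 / (N : ℝ) * (2 * E) := mul_le_mul_of_nonneg_left h3 (by positivity)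
    _ ≤ 1 * (2 * E) := mul_le_mul_of_nonneg_right h4 (by positivity)
    _ = 2 * E := one_mul _

theorem eot_convergence (n N : ℕ) (hN : 2 ≤ N) (G : SimpleGraph (Fin N))
    [DecidableRel G.Adj] (hG : G.Connected) (p q : Fin n → ℝ) (hp : p ∈ stdSimplex ℝ (Fin n))
    (hq : q ∈ stdSimplex ℝ (Fin n)) (C : Fin N → Matrix (Fin n) (Fin n) ℝ)
    (hC : ∀ i a j, 0 ≤ C i a j) :
    ∃ η₀ : ℝ, 0 < η₀ ∧
      ∀ (ρ : ℝ) (β τ : Fin N → ℝ),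
        StepSizeCondition G (fun i => eotBlock G (C i) i) ρ β τ →
      ∃ K₀ : ℝ, 0 < K₀ ∧
        ∀ η : ℝ, 0 < η → η ≤ 1 → ∀ ε : ℝ, 0 < ε → (η ≤ ε ∨ η ≤ η₀) →
        ∀ k : ℕ, K₀ / ε ≤ (k : ℝ) →
        ∀ xhat : Fin N × (Fin n × Fin n) → ℝ,
          IsSimplexProjection
            (ergodicAverage G
              (fun i => eotAgent G p q i (C i) η ρ (β i) (τ i)) k) xhat →
          IsApproxEOT C p q ε (fun i => Matrix.of fun a j => xhat (i, (a, j))) := by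
  have : Nontrivial (Fin N) := Fin.nontrivial_iff_two_le.mpr hN
  set A : Fin N → Matrix (MargRow n ⊕ Fin (N - 1)) (Fin n × Fin n) ℝ :=
    fun i => eotBlock G (C i) i with hA
  set c : Fin N → Fin n × Fin n → ℝ := fun i => vecEntries (C i) with hc
  set B : ℝ := ∑ v : Fin N × (Fin n × Fin n), |c v.1 v.2| with hB
  set d : ℝ := ((Fintype.card (Fin N × (Fin n × Fin n)) : ℕ) : ℝ) with hd
  have hB0 : 0 ≤ B := sum_nonneg fun _ _ => abs_nonneg _
  have hd0 : 0 ≤ d := Nat.cast_nonneg _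
  have hfeas := stacked_eotBlock_eq_iff G hG hp hq C
  have htotal : ∀ x : Fin N × (Fin n × Fin n) → ℝ, (∀ v, 0 ≤ x v) →
      stackedMatrix A *ᵥ x = eotRhs N p q → ∑ v, x v = 1 := by
    intro x hx hMx
    have h1 := ((hfeas x).mp ⟨hx, hMx⟩).2.2.1
    rw [← hp.2, ← h1]
    simp only [mulVec_one_apply, of_apply, Fintype.sum_prod_type, Matrix.sum_apply]
    rw [sum_comm]
    exact sum_congr rfl fun a _ => sum_comm
  have hne : ∃ x : Fin N × (Fin n × Fin n) → ℝ, (∀ v, 0 ≤ x v) ∧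
      stackedMatrix A *ᵥ x = eotRhs N p q := by
    obtain ⟨t, ht0, ht1, ht⟩ := exists_equalizing_weights (by omega)
      (fun k => cost (C k) (of fun a j => p a * q j)) fun k =>
        sum_nonneg fun a _ => sum_nonneg fun j _ =>
          mul_nonneg (hC k a j) (mul_nonneg (hp.1 a) (hq.1 j))
    have hsum : (∑ k, of fun a j => t k * (p a * q j) : Matrix (Fin n) (Fin n) ℝ)
        = of fun a j => p a * q j := by
      ext a j
      simp only [Matrix.sum_apply, of_apply]
      rw [← sum_mul, ht1, one_mul]
    refine ⟨fun v => t v.1 * (p v.2.1 * q v.2.2), (hfeas _).mpr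
      ⟨fun k a j => mul_nonneg (ht0 k) (mul_nonneg (hp.1 a) (hq.1 j)), fun k l => ?_, ?_, ?_⟩⟩
    · have h1 : ∀ k, cost (C k) (of fun a j => t k * (p a * q j))
          = t k * cost (C k) (of fun a j => p a * q j) := by
        intro k
        simp only [cost, of_apply, mul_sum]
        exact sum_congr rfl fun a _ => sum_congr rfl fun j _ => by ring
      simp only [h1]
      exact ht k l
    · simp only [hsum]
      funext a
      simp [mulVec_one_apply, ← mul_sum, hq.2]
    · simp only [hsum]
      funext a
      simp [mulVec_one_apply, ← sum_mul, hp.2]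
  -- As for plain transport, with an extra `2 * B` for the mean deviation of the individual costs,
  -- which are Lipschitz with constant `B`.
  obtain ⟨η₀, hη₀, h⟩ := coupled_convergence hG A (eotRhs N p q) c hne htotal
    (w := B * d + (2 + 2 * B) * (d + 1)) (by positivity)
  refine ⟨η₀, hη₀, fun ρ β τ hstep => ?_⟩
  obtain ⟨K₀, hK₀, h⟩ := h ρ β τ hstep
  refine ⟨K₀, hK₀, fun η hη hη1 ε hε hηε k hk xhat hproj => ?_⟩
  have hagent : (fun i => eotAgent G p q i (C i) η ρ (β i) (τ i))
      = coupledAgent A (eotRhs N p q) c η ρ β τ := by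
    funext i
    simp [eotAgent, coupledAgent, hc, hA]
  rw [hagent] at hproj
  obtain ⟨x, xs, hx, hxs, hopt, hle⟩ := h η hη hη1 ε hε hηε k hk
  set u := ergodicAverage G (coupledAgent A (eotRhs N p q) c η ρ β τ) k with hu
  have hxF := (hfeas x).mp hx
  obtain ⟨hb1, hb2⟩ := hproj.bounds ⟨hx.1, htotal x hx.1 hx.2⟩ (fun v => c v.1 v.2)
  refine ⟨fun k a j => hproj.1.1 _, fun i => of fun a j => xs (i, (a, j)),
    ⟨(hfeas xs).mp hxs, fun Y hY => ?_⟩, ?_⟩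
  · have hY' := (hfeas fun v => Y v.1 v.2.1 v.2.2).mpr hY
    have := hopt _ hY'.1 hY'.2
    rw [sum_cost_eq_sum]
    exact this.trans (le_of_eq (sum_cost_eq_sum C fun v => Y v.1 v.2.1 v.2.2).symm)
  · have h1 := euclNorm_marginal_sub_le (∑ k, of fun a j => xhat (k, (a, j)))
      (∑ k, of fun a j => x (k, (a, j)))
    have h2 := euclNorm_marginal_transpose_sub_le (∑ k, of fun a j => xhat (k, (a, j)))
      (∑ k, of fun a j => x (k, (a, j)))
    rw [hxF.2.2.1] at h1
    rw [hxF.2.2.2] at h2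
    have h3 : ∑ a, ∑ j, |(∑ k, of fun a j => xhat (k, (a, j)) : Matrix (Fin n) (Fin n) ℝ) a j
        - (∑ k, of fun a j => x (k, (a, j)) : Matrix (Fin n) (Fin n) ℝ) a j|
        ≤ ∑ v, |xhat v - x v| := by
      have h4 : ∑ v, |xhat v - x v|
          = ∑ a, ∑ j, ∑ k, |xhat (k, (a, j)) - x (k, (a, j))| := by
        rw [Fintype.sum_prod_type]
        simp only [Fintype.sum_prod_type]
        rw [sum_comm]
        exact sum_congr rfl fun a _ => sum_comm
      rw [h4]
      refine sum_le_sum fun a _ => sum_le_sum fun j _ => ?_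
      simp only [Matrix.sum_apply, of_apply, ← sum_sub_distrib]
      exact abs_sum_le_sum_abs _ _
    have h5 := mean_abs_deviation_le (by omega : 1 ≤ N)
      (fun k => cost (C k) (of fun a j => xhat (k, (a, j))))
      (fun k => cost (C k) (of fun a j => x (k, (a, j)))) hxF.2.1
    have h6 : ∑ k, |cost (C k) (of fun a j => xhat (k, (a, j)))
        - cost (C k) (of fun a j => x (k, (a, j)))| ≤ B * ∑ v, |xhat v - x v| := by
      calc _ ≤ ∑ k, ∑ v, |c k v| * |xhat (k, v) - x (k, v)| := by
            refine sum_le_sum fun k _ => ?_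
            rw [cost_eq_sum (C k) fun v => xhat (k, v), cost_eq_sum (C k) fun v => x (k, v),
              ← sum_sub_distrib]
            refine (abs_sum_le_sum_abs _ _).trans (sum_le_sum fun v _ => ?_)
            rw [← mul_sub, abs_mul]
        _ = ∑ v : Fin N × (Fin n × Fin n), |c v.1 v.2| * |xhat v - x v| := by
            rw [Fintype.sum_prod_type (f := fun v : Fin N × (Fin n × Fin n) =>
              |c v.1 v.2| * |xhat v - x v|)]
        _ ≤ _ := by
            rw [hB, sum_mul]
            refine sum_le_sum fun v _ => mul_le_mul_of_nonneg_left ?_ (abs_nonneg _)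
            exact single_le_sum (f := fun v => |xhat v - x v|) (fun _ _ => abs_nonneg _)
              (mem_univ v)
    beta_reduce
    rw [sum_cost_eq_sum, sum_cost_eq_sum]
    rw [sum_cost_eq_sum] at h5
    rw [← hd] at hb1 hb2
    have h7 := mul_le_mul_of_nonneg_left hb2 hB0
    simp only [hc] at hb1 hle
    rw [show (∑ v : Fin N × (Fin n × Fin n), |vecEntries (C v.1) v.2|) = B from rfl] at hb1
    linarith

/-! ## Arithmetic cost of one iteration -/

section Programs

variable {I : Type}

theorem runCode_append (input : I → ℝ) (code code' : List (Instr I)) (regs : List ℝ) :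
    runCode input (code ++ code') regs = runCode input code' (runCode input code regs) := by
  induction code generalizing regs with
  | nil => rfl
  | cons ins code ih => exact ih _

theorem runCode_prefix (input : I → ℝ) (code : List (Instr I)) (regs : List ℝ) :
    ∃ t, runCode input code regs = regs ++ t := by
  induction code generalizing regs with
  | nil => exact ⟨[], by simp [runCode]⟩
  | cons ins code ih =>
    obtain ⟨t, ht⟩ := ih (regs ++ [ins.val input regs])
    exact ⟨[ins.val input regs] ++ t, by rw [runCode, ht, List.append_assoc]⟩

theorem length_runCode (input : I → ℝ) (code : List (Instr I)) (regs : List ℝ) :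
    (runCode input code regs).length = regs.length + code.length := by
  induction code generalizing regs with
  | nil => rfl
  | cons ins code ih => rw [runCode, ih]; simp; omega

/-- After running `code`, some operand holds the value `f`, and keeps it. -/
def Available (code : List (Instr I)) (f : (I → ℝ) → ℝ) : Prop :=
  ∃ o : Operand I, ∀ ext input, o.val input (runCode input (code ++ ext) []) = f input

theorem Available.append {code : List (Instr I)} {f : (I → ℝ) → ℝ} (h : Available code f)
    (code' : List (Instr I)) : Available (code ++ code') f := by
  obtain ⟨o, ho⟩ := h
  exact ⟨o, fun ext input => by rw [List.append_assoc]; exact ho _ _⟩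

/-- Results are appended in order from an empty list, so the new one sits at index `code.length`;
later instructions never overwrite it. -/
theorem available_append_instr (code : List (Instr I)) (ins : Instr I) :
    Available (code ++ [ins]) fun input => ins.val input (runCode input code []) := by
  refine ⟨.reg code.length, fun ext input => ?_⟩
  obtain ⟨t, ht⟩ := runCode_prefix input ext
    (runCode input code [] ++ [ins.val input (runCode input code [])])
  have hlen : (runCode input code []).length = code.length := by
    rw [length_runCode]; simp
  rw [runCode_append, runCode_append]
  simp only [runCode, Operand.val]
  rw [ht, List.append_assoc, List.getD_append_right _ _ _ _ hlen.le, hlen]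
  simp

/-- The function `f` is computed with at most the given number of operations from the functions
in `S`. -/
inductive Derivable (S : Set ((I → ℝ) → ℝ)) : ℕ → ((I → ℝ) → ℝ) → Prop
  | mem {f} (h : f ∈ S) : Derivable S 0 f
  | nat (m : ℕ) : Derivable S 1 fun _ => (m : ℝ)
  | add {a b f g} (hf : Derivable S a f) (hg : Derivable S b g) :
      Derivable S (a + b + 1) fun w => f w + g w
  | sub {a b f g} (hf : Derivable S a f) (hg : Derivable S b g) :
      Derivable S (a + b + 1) fun w => f w - g w
  | mul {a b f g} (hf : Derivable S a f) (hg : Derivable S b g) :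
      Derivable S (a + b + 1) fun w => f w * g w
  | div {a b f g} (hf : Derivable S a f) (hg : Derivable S b g) :
      Derivable S (a + b + 1) fun w => f w / g w
  | pos {a f} (hf : Derivable S a f) : Derivable S (a + 1) fun w => max (f w) 0
  | weaken {a b f} (hf : Derivable S a f) (hab : a ≤ b) : Derivable S b f

theorem available_binary {S : Set ((I → ℝ) → ℝ)} {a b : ℕ} {f g : (I → ℝ) → ℝ}
    (hf : ∀ code : List (Instr I), (∀ f ∈ S, Available code f) →
      ∃ ext : List (Instr I), ext.length ≤ a ∧ Available (code ++ ext) f)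
    (hg : ∀ code : List (Instr I), (∀ f ∈ S, Available code f) →
      ∃ ext : List (Instr I), ext.length ≤ b ∧ Available (code ++ ext) g)
    (ins : Operand I → Operand I → Instr I) (op : ℝ → ℝ → ℝ)
    (hins : ∀ u v input regs,
      (ins u v).val input regs = op (u.val input regs) (v.val input regs))
    (code : List (Instr I)) (hcode : ∀ f ∈ S, Available code f) :
    ∃ ext : List (Instr I), ext.length ≤ a + b + 1 ∧
      Available (code ++ ext) fun w => op (f w) (g w) := by
  obtain ⟨e₁, h₁, h₁'⟩ := hf code hcode
  obtain ⟨e₂, h₂, h₂'⟩ := hg (code ++ e₁) fun f hf => (hcode f hf).append _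
  obtain ⟨u, hu⟩ := h₁'.append e₂
  obtain ⟨v, hv⟩ := h₂'
  refine ⟨e₁ ++ e₂ ++ [ins u v], by simp; omega, ?_⟩
  have h := available_append_instr (code ++ e₁ ++ e₂) (ins u v)
  have hu' := hu []
  have hv' := hv []
  rw [List.append_nil] at hu' hv'
  simp only [hins, hu', hv'] at h
  simpa only [List.append_assoc] using h

/-- Quantifying over all codes that provide `S` lets the code of the second operand be built on top
of that of the first. Nothing is shared inside one derivation; sharing comes from enlarging `S`. -/
theorem Derivable.exists_code {S : Set ((I → ℝ) → ℝ)} {e : ℕ} {f : (I → ℝ) → ℝ}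
    (h : Derivable S e f) : ∀ code : List (Instr I), (∀ f ∈ S, Available code f) →
      ∃ ext : List (Instr I), ext.length ≤ e ∧ Available (code ++ ext) f := by
  induction h with
  | mem h => exact fun code hcode => ⟨[], le_rfl, (hcode _ h).append _⟩
  | nat m => exact fun code _ => ⟨[.nat m], le_rfl, available_append_instr code (.nat m)⟩
  | add _ _ ihf ihg => exact available_binary ihf ihg .add _ fun _ _ _ _ => rfl
  | sub _ _ ihf ihg => exact available_binary ihf ihg .sub _ fun _ _ _ _ => rfl
  | mul _ _ ihf ihg => exact available_binary ihf ihg .mul _ fun _ _ _ _ => rfl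
  | div _ _ ihf ihg => exact available_binary ihf ihg .div _ fun _ _ _ _ => rfl
  | pos _ ihf =>
    intro code hcode
    obtain ⟨e₁, h₁, u, hu⟩ := ihf code hcode
    refine ⟨e₁ ++ [.pos u], by simpa using h₁, ?_⟩
    have h := available_append_instr (code ++ e₁) (.pos u)
    have hu' := hu []
    rw [List.append_nil] at hu'
    simp only [Instr.val, hu'] at h
    simpa only [List.append_assoc] using h
  | weaken _ hab ih =>
    intro code hcode
    obtain ⟨ext, h₁, h₂⟩ := ih code hcode
    exact ⟨ext, h₁.trans hab, h₂⟩

theorem Derivable.zero {S : Set ((I → ℝ) → ℝ)} : Derivable S 1 fun _ => (0 : ℝ) := by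
  simpa using Derivable.nat (S := S) 0

theorem Derivable.one {S : Set ((I → ℝ) → ℝ)} : Derivable S 1 fun _ => (1 : ℝ) := by
  simpa using Derivable.nat (S := S) 1

theorem Derivable.two {S : Set ((I → ℝ) → ℝ)} : Derivable S 1 fun _ => (2 : ℝ) := by
  simpa using Derivable.nat (S := S) 2

/-- One addition per term, and one instruction to load the zero of the empty sum. -/
theorem Derivable.sum {ι : Type*} {S : Set ((I → ℝ) → ℝ)} {e : ℕ} (s : Finset ι)
    {f : ι → (I → ℝ) → ℝ} (h : ∀ j, Derivable S e (f j)) :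
    Derivable S (s.card * (e + 1) + 1) fun w => ∑ j ∈ s, f j w := by
  classical
  induction s using Finset.induction_on with
  | empty => simpa using Derivable.zero
  | insert j s hj ih =>
    simp only [sum_insert hj, card_insert_of_notMem hj]
    exact ((h j).add ih).weaken (by ring_nf; omega)

/-- All functions in `S` are computed by some code with at most `m` instructions. -/
def Computed (S : Set ((I → ℝ) → ℝ)) (m : ℕ) : Prop :=
  ∃ code : List (Instr I), code.length ≤ m ∧ ∀ f ∈ S, Available code f

theorem computed_inputs : Computed (Set.range fun (v : I) (w : I → ℝ) => w v) 0 := by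
  refine ⟨[], le_rfl, ?_⟩
  rintro _ ⟨v, rfl⟩
  exact ⟨.inp v, fun _ _ => rfl⟩

theorem Computed.family {ι : Type*} [Fintype ι] {S : Set ((I → ℝ) → ℝ)} {m e : ℕ}
    (h : Computed S m) {f : ι → (I → ℝ) → ℝ} (hf : ∀ r, Derivable S e (f r)) :
    Computed (S ∪ Set.range f) (m + Fintype.card ι * e) := by
  classical
  obtain ⟨code, hlen, hcode⟩ := h
  have key : ∀ s : Finset ι, ∃ ext : List (Instr I), ext.length ≤ s.card * e ∧
      ∀ r ∈ s, Available (code ++ ext) (f r) := by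
    intro s
    induction s using Finset.induction_on with
    | empty => exact ⟨[], by simp, by simp⟩
    | insert j s hj ih =>
      obtain ⟨ext, h₁, h₂⟩ := ih
      obtain ⟨ext', h₁', h₂'⟩ := (hf j).exists_code (code ++ ext) fun g hg =>
        (hcode g hg).append _
      refine ⟨ext ++ ext', ?_, fun r hr => ?_⟩
      · rw [card_insert_of_notMem hj, List.length_append, add_mul]; omega
      · rw [← List.append_assoc]
        rcases mem_insert.mp hr with rfl | hr
        · exact h₂'
        · exact (h₂ r hr).append _
  obtain ⟨ext, h₁, h₂⟩ := key univ
  refine ⟨code ++ ext, ?_, ?_⟩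
  · rw [List.length_append]
    exact add_le_add hlen h₁
  · rintro g (hg | ⟨r, rfl⟩)
    · exact (hcode g hg).append _
    · exact h₂ r (mem_univ r)

theorem Computed.exists_program {O : Type} {S : Set ((I → ℝ) → ℝ)} {m : ℕ} (h : Computed S m)
    {g : O → (I → ℝ) → ℝ} (hg : ∀ o, g o ∈ S) :
    ∃ P : Program I O, P.opCount ≤ m ∧ ∀ w, P.eval w = fun o => g o w := by
  obtain ⟨code, hlen, hcode⟩ := h
  choose out hout using fun o => hcode (g o) (hg o)
  refine ⟨⟨code, out⟩, hlen, fun w => funext fun o => ?_⟩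
  have := hout o [] w
  rw [List.append_nil] at this
  exact this

/-- Multiplication of a vector by the matrix `F` takes at most `K` operations. -/
def MulVecCost {α β : Type} [Fintype β] (F : (I → ℝ) → Matrix α β ℝ) (K : ℕ) : Prop :=
  ∀ (S : Set ((I → ℝ) → ℝ)) (m : ℕ), (∀ v, (fun w : I → ℝ => w v) ∈ S) → Computed S m →
    ∀ x : β → (I → ℝ) → ℝ, (∀ r, x r ∈ S) →
      ∃ S', S ⊆ S' ∧ Computed S' (m + K) ∧ ∀ r, (fun w => (F w *ᵥ fun a => x a w) r) ∈ S'

end Programs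

/-! ### A straight-line program for one iteration of an agent. -/

section AgentProgram

variable {κ μ ν : Type} [Fintype κ] [Fintype μ] [Fintype ν]

/-- The agent described by the inputs of a program. -/
def inputAgent (A : (AgentInput κ μ ν → ℝ) → Matrix μ κ ℝ) (N : ℕ) (w : AgentInput κ μ ν → ℝ) :
    Agent κ μ where
  A := A w
  b := fun r => w (.b r)
  c := fun r => w (.c r)
  N := N
  η := w .η
  ρ := w .ρ
  β := w .β
  τ := w .τ

/-- The state described by the inputs of a program. -/
def inputState (w : AgentInput κ μ ν → ℝ) : LocalState κ μ where
  x := fun r => w (.x r)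
  y := fun r => w (.y r)
  z := fun r => w (.z r)
  lam := fun r => w (.lam r)
  p := fun r => w (.p r)

/-- Two products with `A` (at the old and the new `x`) and one with its transpose suffice. The
neighbour sum is computed once and reused, so the neighbours cost only two passes, for it and for
`p`. -/
theorem exists_step_program (A : (AgentInput κ μ ν → ℝ) → Matrix μ κ ℝ) (N : ℕ) {K K' : ℕ}
    (hA : MulVecCost A K) (hAT : MulVecCost (fun w => (A w)ᵀ) K') :
    ∃ P : Program (AgentInput κ μ ν) (AgentOutput κ μ),
      P.opCount ≤ 2 * K + K' + 80 * Fintype.card κ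
          + (60 + 4 * Fintype.card ν) * Fintype.card μ ∧
        ∀ w, P.eval w = stateValues ((inputAgent A N w).step (inputState w)
          (fun (j : ν) r => w (.msg j r)) (fun j r => w (.msgNext j r))) := by
  set ag := inputAgent A N with hag
  let st : (AgentInput κ μ ν → ℝ) → LocalState κ μ := inputState
  let msg : (AgentInput κ μ ν → ℝ) → ν → μ → ℝ := fun w j r => w (.msg j r)
  let msgNext : (AgentInput κ μ ν → ℝ) → ν → μ → ℝ := fun w j r => w (.msgNext j r)
  have inp : ∀ {S : Set ((AgentInput κ μ ν → ℝ) → ℝ)} (_ : ∀ v, (fun w => w v) ∈ S) (v),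
      Derivable S 0 fun w => w v := fun h v => .mem (h v)
  have h0 := computed_inputs (I := AgentInput κ μ ν)
  set S0 := Set.range fun (v : AgentInput κ μ ν) (w : AgentInput κ μ ν → ℝ) => w v
  have i0 : ∀ v, (fun w : AgentInput κ μ ν → ℝ => w v) ∈ S0 := fun v => ⟨v, rfl⟩
  -- `y`
  have h1 := h0.family (e := 20) (f := fun r w => (ag w).yNext (st w) r) fun r => by
    have hinv : Derivable S0 3 fun w => 1 / (w .β * w .τ) :=
      (Derivable.one.div ((inp i0 .β).mul (inp i0 .τ)))
    exact ((((Derivable.one.sub hinv).mul (inp i0 (.y r))).add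
      (hinv.mul ((inp i0 (.x r)).sub ((inp i0 .τ).mul (inp i0 (.z r)))))).pos).weaken (by norm_num)
  set S1 := S0 ∪ Set.range fun r w => (ag w).yNext (st w) r
  have s1 : S0 ⊆ S1 := Set.subset_union_left
  -- the sum over the neighbours
  have h2 := h1.family (e := 2 * Fintype.card ν + 1) (f := fun r w => Agent.nbrSum (st w) (msg w) r) fun r => by
    have := Derivable.sum (S := S1) (univ : Finset ν) fun j =>
      (inp (fun v => s1 (i0 v)) (.msg j r)).add (inp (fun v => s1 (i0 v)) (.lam r))
    have h' : (fun w => Agent.nbrSum (st w) (msg w) r)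
        = fun w => ∑ j, (w (.msg j r) + w (.lam r)) := by
      funext w
      simp only [Agent.nbrSum, Finset.sum_apply]
      rfl
    rw [h']
    exact this.weaken (by rw [card_univ]; omega)
  set S2 := S1 ∪ Set.range fun r w => Agent.nbrSum (st w) (msg w) r
  have s2 : S0 ⊆ S2 := s1.trans Set.subset_union_left
  -- the residual of the coupling constraint
  obtain ⟨S3, s23, h3, h3'⟩ := hA S2 _ (fun v => s2 (i0 v)) h2 (fun r w => w (.x r))
    fun r => s2 (i0 _)
  have s3 : S0 ⊆ S3 := s2.trans s23
  have i3 := fun v => s3 (i0 v)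
  have h4 := h3.family (e := 12) (f := fun r w => ((ag w).A *ᵥ (st w).x - (1 / ((ag w).N : ℝ)) •
      (ag w).b - (st w).p + (ag w).ρ • Agent.nbrSum (st w) (msg w)) r) fun r => by
    have hb : Derivable S3 4 fun w => 1 / (N : ℝ) * w (.b r) :=
      ((Derivable.one.div (.nat N)).mul (inp i3 (.b r)))
    have hn : Derivable S3 0 fun w => Agent.nbrSum (st w) (msg w) r := .mem (s23 (Or.inr ⟨r, rfl⟩))
    exact (((((Derivable.mem (h3' r)).sub hb).sub (inp i3 (.p r))).add
      ((inp i3 .ρ).mul hn))).weaken (by norm_num)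
  set S4 := S3 ∪ Set.range fun r w => ((ag w).A *ᵥ (st w).x - (1 / ((ag w).N : ℝ)) •
      (ag w).b - (st w).p + (ag w).ρ • Agent.nbrSum (st w) (msg w)) r with hS4
  have s34 : S3 ⊆ S4 := Set.subset_union_left
  obtain ⟨S5, s45, h5, h5'⟩ := hAT S4 _ (fun v => s34 (i3 v)) h4
    (fun r w => ((ag w).A *ᵥ (st w).x - (1 / ((ag w).N : ℝ)) •
      (ag w).b - (st w).p + (ag w).ρ • Agent.nbrSum (st w) (msg w)) r) fun r => Or.inr ⟨r, rfl⟩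
  have i5 := fun v => s45 (s34 (i3 v))
  have s15 : S1 ⊆ S5 := fun f hf => s45 (s34 (s23 (Or.inl hf)))
  have s25 : S2 ⊆ S5 := fun f hf => s45 (s34 (s23 hf))
  have y5 : ∀ r, Derivable S5 0 fun w => (ag w).yNext (st w) r := fun r =>
    .mem (s15 (Or.inr ⟨r, rfl⟩))
  -- `x`
  have h6 := h5.family (e := 30) (f := fun r w => (ag w).xNext (st w) (msg w) r) fun r => by
    have e1 : Derivable S5 3 fun w => w (.c r) + w .η * w (.x r) :=
      ((inp i5 (.c r)).add ((inp i5 .η).mul (inp i5 (.x r)))).weaken (by norm_num)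
    have e2 : Derivable S5 6 fun w =>
        1 / w .τ * (w (.x r) - (ag w).yNext (st w) r - w .τ * w (.z r)) :=
      ((Derivable.one.div (inp i5 .τ)).mul (((inp i5 (.x r)).sub (y5 r)).sub
        ((inp i5 .τ).mul (inp i5 (.z r))))).weaken (by norm_num)
    have e3 := (Derivable.one.div ((Derivable.two.mul (inp i5 .ρ)).mul
      (.nat (Fintype.card ν)))).mul (Derivable.mem (h5' r))
    exact ((inp i5 (.x r)).sub ((Derivable.one.div (inp i5 .β)).mul
      ((e1.add e2).add e3))).weaken (by norm_num)
  set S6 := S5 ∪ Set.range fun r w => (ag w).xNext (st w) (msg w) r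
  have s56 : S5 ⊆ S6 := Set.subset_union_left
  obtain ⟨S7, s67, h7, h7'⟩ := hA S6 _ (fun v => s56 (i5 v)) h6
    (fun r w => (ag w).xNext (st w) (msg w) r) fun r => Or.inr ⟨r, rfl⟩
  have s57 : S5 ⊆ S7 := s56.trans s67
  have i7 := fun v => s57 (i5 v)
  -- `λ`
  have h8 := h7.family (e := 30) (f := fun r w => (ag w).lamNext (st w) (msg w) r) fun r => by
    have hn : Derivable S7 0 fun w => Agent.nbrSum (st w) (msg w) r :=
      .mem (s57 (s25 (Or.inr ⟨r, rfl⟩)))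
    have hb : Derivable S7 4 fun w => 1 / (N : ℝ) * w (.b r) :=
      ((Derivable.one.div (.nat N)).mul (inp i7 (.b r))).weaken (by norm_num)
    have hr : Derivable S7 2 fun w => 1 / w .ρ := Derivable.one.div (inp i7 .ρ)
    exact ((Derivable.one.div (Derivable.two.mul (.nat (Fintype.card ν)))).mul
      ((hn.sub (hr.mul (inp i7 (.p r)))).add
        (hr.mul ((Derivable.mem (h7' r)).sub hb)))).weaken (by norm_num)
  set S8 := S7 ∪ Set.range fun r w => (ag w).lamNext (st w) (msg w) r
  have s78 : S7 ⊆ S8 := Set.subset_union_left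
  have i8 := fun v => s78 (i7 v)
  -- `z`
  have h9 := h8.family (e := 30) (f := fun r w => (ag w).zNext (st w) (msg w) r) fun r => by
    have hx : Derivable S8 0 fun w => (ag w).xNext (st w) (msg w) r :=
      .mem (s78 (s67 (Or.inr ⟨r, rfl⟩)))
    have hy : Derivable S8 0 fun w => (ag w).yNext (st w) r :=
      .mem (s78 (s57 (s15 (Or.inr ⟨r, rfl⟩))))
    exact ((inp i8 (.z r)).add ((Derivable.one.div (inp i8 .τ)).mul (hy.sub hx))).weaken
      (by norm_num)
  set S9 := S8 ∪ Set.range fun r w => (ag w).zNext (st w) (msg w) r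
  have s89 : S8 ⊆ S9 := Set.subset_union_left
  have i9 := fun v => s89 (i8 v)
  -- `p`
  have h10 := h9.family (e := 2 * Fintype.card ν + 3) (f := fun r w => (ag w).pNext (st w) (msg w) (msgNext w) r) fun r => by
    have hl : Derivable S9 0 fun w => (ag w).lamNext (st w) (msg w) r :=
      .mem (s89 (Or.inr ⟨r, rfl⟩))
    have hs := Derivable.sum (S := S9) (univ : Finset ν) fun j =>
      hl.sub (inp i9 (.msgNext j r))
    have h' : (fun w => (ag w).pNext (st w) (msg w) (msgNext w) r)
        = fun w => w (.p r) + w .ρ * ∑ j, ((ag w).lamNext (st w) (msg w) r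
          - w (.msgNext j r)) := by
      funext w
      simp only [Agent.pNext, Pi.add_apply, Pi.smul_apply, Finset.sum_apply, smul_eq_mul]
      rfl
    rw [h']
    exact ((inp i9 (.p r)).add ((inp i9 .ρ).mul hs)).weaken (by rw [card_univ]; omega)
  have hfin := h10.exists_program (O := AgentOutput κ μ)
    (g := fun o w => stateValues ((ag w).step (st w) (msg w) (msgNext w)) o) fun o => by
    cases o with
    | x r => exact Or.inl (s89 (s78 (s67 (Or.inr ⟨r, rfl⟩))))
    | y r => exact Or.inl (s89 (s78 (s57 (s15 (Or.inr ⟨r, rfl⟩)))))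
    | z r => exact Or.inl (Or.inr ⟨r, rfl⟩)
    | lam r => exact Or.inl (s89 (Or.inr ⟨r, rfl⟩))
    | p r => exact Or.inr ⟨r, rfl⟩
  obtain ⟨P, hP, hP'⟩ := hfin
  refine ⟨P, hP.trans ?_, hP'⟩
  ring_nf
  omega

end AgentProgram

theorem Computed.mono {I : Type} {S : Set ((I → ℝ) → ℝ)} {m m' : ℕ} (h : Computed S m)
    (hm : m ≤ m') : Computed S m' := by
  obtain ⟨code, h₁, h₂⟩ := h
  exact ⟨code, h₁.trans hm, h₂⟩

/-- The condition does not depend on the inputs: it is decided when the program is written, so no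
branching instruction is needed. -/
theorem Derivable.ite {I : Type} {S : Set ((I → ℝ) → ℝ)} {f : (I → ℝ) → ℝ} (P : Prop)
    [Decidable P] (h : f ∈ S) : Derivable S 1 fun w => if P then f w else 0 := by
  split_ifs
  · exact (Derivable.mem h).weaken (Nat.zero_le 1)
  · exact Derivable.zero

/-! ### Cost of multiplication by the constraint matrices. -/

section Marginal

variable {I : Type} {n : ℕ}

theorem margBlockT_transpose_mulVec (i : Fin n) (y : MargRow n → ℝ) (a : Fin n) :
    ((margBlockT n i)ᵀ *ᵥ y) a
      = y (Sum.inl a) + ∑ s, if notLast s = i then y (Sum.inr s) else 0 := by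
  simp [margBlockT, margBlock, mulVec, dotProduct, Matrix.one_apply]

theorem margMatrixT_transpose_mulVec (y : MargRow n → ℝ) (v : Fin n × Fin n) :
    ((margMatrixT n)ᵀ *ᵥ y) v
      = y (Sum.inl v.1) + ∑ s, if notLast s = v.2 then y (Sum.inr s) else 0 :=
  margBlockT_transpose_mulVec v.2 y v.1

/-- Beyond copying `x`, the product contains only the total of `x`, which is computed once. -/
theorem mulVecCost_margBlockT (i : Fin n) :
    MulVecCost (fun _ : I → ℝ => margBlockT n i) (4 * n + 1) := by
  intro S m _ hS x hx
  have h1 := hS.family (ι := Unit) (f := fun _ w => ∑ a, x a w) fun _ =>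
    Derivable.sum univ fun a => Derivable.mem (hx a)
  have h2 := h1.family (e := 1)
    (f := fun r w => (margBlockT n i *ᵥ fun a => x a w) r) fun r => by
      rcases r with a | s
      · simp only [margBlockT_mulVec_inl]
        exact (Derivable.mem (Or.inl (hx a))).weaken (Nat.zero_le 1)
      · simp only [margBlockT_mulVec_inr]
        exact Derivable.ite _ (Or.inr ⟨(), rfl⟩)
  refine ⟨_, ?_, h2.mono ?_, fun r => ?_⟩
  · exact Set.subset_union_left.trans Set.subset_union_left
  rotate_left
  · exact Or.inr ⟨r, rfl⟩
  simp only [card_univ, Fintype.card_unit, Fintype.card_sum, Fintype.card_fin]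
  omega

theorem mulVecCost_margBlockT_transpose (i : Fin n) :
    MulVecCost (fun _ : I → ℝ => (margBlockT n i)ᵀ) (4 * n + 1) := by
  intro S m _ hS y hy
  have h1 := hS.family (ι := Unit)
    (f := fun _ w => ∑ s, if notLast s = i then y (Sum.inr s) w else 0) fun _ =>
    Derivable.sum univ fun s => Derivable.ite (notLast s = i) (hy (Sum.inr s))
  have h2 := h1.family (e := 1)
    (f := fun a w => ((margBlockT n i)ᵀ *ᵥ fun r => y r w) a) fun a => by
      simp only [margBlockT_transpose_mulVec]
      exact (Derivable.mem (Or.inl (hy (Sum.inl a)))).add (Derivable.mem (Or.inr ⟨(), rfl⟩))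
  refine ⟨_, ?_, h2.mono ?_, fun r => ?_⟩
  · exact Set.subset_union_left.trans Set.subset_union_left
  rotate_left
  · exact Or.inr ⟨r, rfl⟩
  simp only [card_univ, Fintype.card_unit, Fintype.card_fin]
  omega

variable {N : ℕ} (G : SimpleGraph (Fin N)) [DecidableRel G.Adj]

/-- Only natural numbers can be loaded, so an entry is a difference of two of them. -/
theorem derivable_lapMatrix {S : Set ((I → ℝ) → ℝ)} (k i : Fin N) :
    Derivable S 3 fun _ => G.lapMatrix ℝ k i := by
  have h : G.lapMatrix ℝ k i
      = ((if k = i then G.degree k else 0 : ℕ) : ℝ) - ((if G.Adj k i then 1 else 0 : ℕ) : ℝ) := by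
    simp only [SimpleGraph.lapMatrix, SimpleGraph.degMatrix, Matrix.sub_apply, diagonal_apply,
      SimpleGraph.adjMatrix_apply]
    push_cast
    rfl
  rw [h]
  exact (Derivable.nat _).sub (Derivable.nat _)

/-- The equity block has rank one: a single inner product with the costs, rescaled for each row,
replaces a dense product of order `N n²`. -/
theorem mulVecCost_eotBlock (i : Fin N) (c : Fin n × Fin n → I) :
    MulVecCost (fun w : I → ℝ => eotBlock G (of fun a j => w (c (a, j))) i)
      (10 * n ^ 2 + 4 * N + 1) := by
  intro S m hinp hS x hx
  have h1 := hS.family (ι := Unit) (f := fun _ w => ∑ v, w (c v) * x v w) fun _ =>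
    Derivable.sum univ fun v => (Derivable.mem (hinp (c v))).mul (Derivable.mem (hx v))
  have h2 := h1.family (e := n + 1)
    (f := fun r w => (margMatrixT n *ᵥ fun v => x v w) r) fun r => by
      rcases r with a | s
      · simp only [margMatrixT_mulVec_inl]
        exact Derivable.sum univ (fun j => Derivable.mem (Or.inl (hx (a, j)))) |>.weaken (by simp)
      · simp only [margMatrixT_mulVec_inr]
        exact Derivable.sum univ (fun a => Derivable.mem (Or.inl (hx (a, notLast s))))
          |>.weaken (by simp)
  have h3 := h2.family (e := 4)
    (f := fun s w => (equityBlock G (of fun a j => w (c (a, j))) i *ᵥ fun v => x v w) s)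
    fun s => by
      have h : (fun w : I → ℝ => (equityBlock G (of fun a j => w (c (a, j))) i *ᵥ
          fun v => x v w) s)
          = fun w => G.lapMatrix ℝ (notLast s) i * ∑ v, w (c v) * x v w := by
        funext w
        rw [equityBlock_mulVec, cost_eq_sum _ fun v => x v w]
        rfl
      rw [h]
      exact (derivable_lapMatrix G _ _).mul (Derivable.mem (Or.inl (Or.inr ⟨(), rfl⟩)))
  refine ⟨_, ?_, h3.mono ?_, fun r => ?_⟩
  · exact Set.subset_union_left.trans (Set.subset_union_left.trans Set.subset_union_left)
  · simp only [card_univ, Fintype.card_unit, Fintype.card_sum, Fintype.card_prod,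
      Fintype.card_fin]
    obtain _ | n := n
    · simp; omega
    · simp only [Nat.add_sub_cancel]
      have : N - 1 ≤ N := Nat.sub_le N 1
      nlinarith
  · rcases r with r | s
    · exact Or.inl (Or.inr ⟨r, funext fun w => by simp only [eotBlock, fromRows_mulVec,
        Sum.elim_inl]⟩)
    · exact Or.inr ⟨s, funext fun w => by simp only [eotBlock, fromRows_mulVec,
        Sum.elim_inr]⟩

/-- The Laplacian combination of the equity multipliers is computed once, and the column selections
once per column rather than per entry of the plan. -/
theorem mulVecCost_eotBlock_transpose (i : Fin N) (c : Fin n × Fin n → I) :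
    MulVecCost (fun w : I → ℝ => (eotBlock G (of fun a j => w (c (a, j))) i)ᵀ)
      (10 * n ^ 2 + 5 * N + 1) := by
  intro S m hinp hS y hy
  have h1 := hS.family (ι := Unit)
    (f := fun _ w => ∑ s, G.lapMatrix ℝ (notLast s) i * y (Sum.inr s) w) fun _ =>
    Derivable.sum univ fun s => (derivable_lapMatrix G _ _).mul (Derivable.mem (hy (Sum.inr s)))
  have h2 := h1.family
    (f := fun (j : Fin n) w => ∑ s, if notLast s = j then y (Sum.inl (Sum.inr s)) w else 0)
    fun j => Derivable.sum univ fun s => Derivable.ite (notLast s = j) (Or.inl (hy _))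
  have h3 := h2.family (e := 3)
    (f := fun v w => ((eotBlock G (of fun a j => w (c (a, j))) i)ᵀ *ᵥ fun r => y r w) v)
    fun v => by
      have h : (fun w : I → ℝ => ((eotBlock G (of fun a j => w (c (a, j))) i)ᵀ *ᵥ
          fun r => y r w) v)
          = fun w => (y (Sum.inl (Sum.inl v.1)) w
              + ∑ s, if notLast s = v.2 then y (Sum.inl (Sum.inr s)) w else 0)
            + w (c v) * ∑ s, G.lapMatrix ℝ (notLast s) i * y (Sum.inr s) w := by
        funext w
        rw [← margMatrixT_transpose_mulVec (fun r => y (Sum.inl r) w) v, mul_sum]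
        simp only [eotBlock, mulVec, dotProduct, transpose_apply, Fintype.sum_sum_type,
          fromRows_apply_inl, fromRows_apply_inr, equityBlock, vecMulVec, of_apply, vecEntries]
        congr 1
        exact sum_congr rfl fun s _ => by ring
      rw [h]
      exact ((Derivable.mem (Or.inl (Or.inl (hy _)))).add
        (Derivable.mem (Or.inr ⟨v.2, rfl⟩))).add
        ((Derivable.mem (Or.inl (Or.inl (hinp _)))).mul
          (Derivable.mem (Or.inl (Or.inr ⟨(), rfl⟩)))) |>.weaken (by norm_num)
  refine ⟨_, ?_, h3.mono ?_, fun r => ?_⟩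
  · exact Set.subset_union_left.trans (Set.subset_union_left.trans Set.subset_union_left)
  rotate_left
  · exact Or.inr ⟨r, rfl⟩
  simp only [card_univ, Fintype.card_unit, Fintype.card_prod, Fintype.card_fin]
  obtain _ | n := n
  · simp; omega
  · simp only [Nat.add_sub_cancel]
    have : N - 1 ≤ N := Nat.sub_le N 1
    nlinarith

end Marginal

/-! ### Operation counts for the two reformulations. -/

theorem exists_ot_program :
    ∃ c₁ : ℕ, ∀ (n : ℕ), 2 ≤ n →
      ∀ (G : SimpleGraph (Fin n)) [DecidableRel G.Adj], G.Connected → ∀ i : Fin n,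
      ∃ P : Program (AgentInput (Fin n) (MargRow n) (G.neighborSet i))
          (AgentOutput (Fin n) (MargRow n)),
        P.opCount ≤ c₁ * (G.degree i * n) ∧
        ∀ (p q c : Fin n → ℝ) (η ρ β τ : ℝ), 0 < η → 0 < ρ → 0 < β → 0 < τ →
          Implements P (otAgent p q i c η ρ β τ) := by
  refine ⟨300, fun n hn G _ hG i => ?_⟩
  obtain ⟨P, hP, hP'⟩ := exists_step_program (ν := G.neighborSet i)
    (fun _ => margBlockT n i) n (mulVecCost_margBlockT i) (mulVecCost_margBlockT_transpose i)
  refine ⟨P, hP.trans ?_, fun p q c η ρ β τ _ _ _ _ s msg msgNext => hP' _⟩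
  have : Nontrivial (Fin n) := Fin.nontrivial_iff_two_le.mpr hn
  -- Every agent has a neighbour, so the terms linear in `n` are absorbed into `G.degree i * n`.
  have hd : 0 < G.degree i := hG.preconnected.degree_pos_of_nontrivial i
  simp only [G.card_neighborSet_eq_degree, Fintype.card_sum, Fintype.card_fin]
  have h1 : n ≤ G.degree i * n := Nat.le_mul_of_pos_left n hd
  have h2 : (60 + 4 * G.degree i) * (n + (n - 1)) ≤ (60 + 4 * G.degree i) * (2 * n) :=
    Nat.mul_le_mul_left _ (by omega)
  have h3 : (60 + 4 * G.degree i) * (2 * n) = 120 * n + 8 * (G.degree i * n) := by ring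
  omega

theorem exists_eot_program :
    ∃ c₂ : ℕ, ∀ (n N : ℕ), 1 ≤ n → 2 ≤ N →
      ∀ (G : SimpleGraph (Fin N)) [DecidableRel G.Adj], G.Connected → ∀ i : Fin N,
      ∃ P : Program (AgentInput (Fin n × Fin n) (MargRow n ⊕ Fin (N - 1)) (G.neighborSet i))
          (AgentOutput (Fin n × Fin n) (MargRow n ⊕ Fin (N - 1))),
        P.opCount ≤ c₂ * (n ^ 2 + G.degree i * (2 * n + N)) ∧
        ∀ (p q : Fin n → ℝ) (C : Matrix (Fin n) (Fin n) ℝ) (η ρ β τ : ℝ),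
          0 < η → 0 < ρ → 0 < β → 0 < τ →
          Implements P (eotAgent G p q i C η ρ β τ) := by
  refine ⟨300, fun n N _ hN G _ hG i => ?_⟩
  obtain ⟨P, hP, hP'⟩ := exists_step_program (ν := G.neighborSet i)
    (fun w => eotBlock G (of fun a j => w (.c (a, j))) i) N
    (mulVecCost_eotBlock G i AgentInput.c) (mulVecCost_eotBlock_transpose G i AgentInput.c)
  refine ⟨P, hP.trans ?_, fun p q C η ρ β τ _ _ _ _ s msg msgNext => hP' _⟩
  have : Nontrivial (Fin N) := Fin.nontrivial_iff_two_le.mpr hN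
  have hd : 0 < G.degree i := hG.preconnected.degree_pos_of_nontrivial i
  simp only [G.card_neighborSet_eq_degree, Fintype.card_sum, Fintype.card_prod, Fintype.card_fin]
  have h1 : 2 * n + N ≤ G.degree i * (2 * n + N) := Nat.le_mul_of_pos_left _ hd
  have h2 : (60 + 4 * G.degree i) * (n + (n - 1) + (N - 1))
      ≤ (60 + 4 * G.degree i) * (2 * n + N) := Nat.mul_le_mul_left _ (by omega)
  have h3 : (60 + 4 * G.degree i) * (2 * n + N)
      = 60 * (2 * n + N) + 4 * (G.degree i * (2 * n + N)) := by ring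
  have h4 : n * n = n ^ 2 := (sq n).symm
  rw [h4]
  omega

end DecOT

theorem corollary1 :
    -- `O(1/ε)` iterations for decentralized optimal transport
    (∀ (n : ℕ), 2 ≤ n → ∀ (G : SimpleGraph (Fin n)) [DecidableRel G.Adj], G.Connected →
      ∀ (p q : Fin n → ℝ), p ∈ stdSimplex ℝ (Fin n) → q ∈ stdSimplex ℝ (Fin n) →
      ∀ (C : Matrix (Fin n) (Fin n) ℝ), (∀ a j, 0 ≤ C a j) →
      ∃ η₀ : ℝ, 0 < η₀ ∧
        ∀ (ρ : ℝ) (β τ : Fin n → ℝ),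
          DecOT.StepSizeCondition G (DecOT.margBlockT n) ρ β τ →
        ∃ K₀ : ℝ, 0 < K₀ ∧
          ∀ η : ℝ, 0 < η → η ≤ 1 → ∀ ε : ℝ, 0 < ε → (η ≤ ε ∨ η ≤ η₀) →
          ∀ k : ℕ, K₀ / ε ≤ (k : ℝ) →
          ∀ xhat : Fin n × Fin n → ℝ,
            DecOT.IsSimplexProjection
              (DecOT.ergodicAverage G
                (fun i => DecOT.otAgent p q i (fun a => C a i) η ρ (β i) (τ i)) k) xhat →
            DecOT.IsApproxOT C p q ε (Matrix.of fun a j => xhat (j, a))) ∧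
    -- `O(1/ε)` iterations for decentralized equitable optimal transport
    (∀ (n N : ℕ), 1 ≤ n → 2 ≤ N →
      ∀ (G : SimpleGraph (Fin N)) [DecidableRel G.Adj], G.Connected →
      ∀ (p q : Fin n → ℝ), p ∈ stdSimplex ℝ (Fin n) → q ∈ stdSimplex ℝ (Fin n) →
      ∀ (C : Fin N → Matrix (Fin n) (Fin n) ℝ), (∀ i a j, 0 ≤ C i a j) →
      ∃ η₀ : ℝ, 0 < η₀ ∧
        ∀ (ρ : ℝ) (β τ : Fin N → ℝ),
          DecOT.StepSizeCondition G (fun i => DecOT.eotBlock G (C i) i) ρ β τ →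
        ∃ K₀ : ℝ, 0 < K₀ ∧
          ∀ η : ℝ, 0 < η → η ≤ 1 → ∀ ε : ℝ, 0 < ε → (η ≤ ε ∨ η ≤ η₀) →
          ∀ k : ℕ, K₀ / ε ≤ (k : ℝ) →
          ∀ xhat : Fin N × (Fin n × Fin n) → ℝ,
            DecOT.IsSimplexProjection
              (DecOT.ergodicAverage G
                (fun i => DecOT.eotAgent G p q i (C i) η ρ (β i) (τ i)) k) xhat →
            DecOT.IsApproxEOT C p q ε (fun i => Matrix.of fun a j => xhat (i, (a, j)))) ∧
    -- arithmetic cost `O(|𝒩ᵢ| n)` per agent and iteration for decentralized optimal transport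
    (∃ c₁ : ℕ, ∀ (n : ℕ), 2 ≤ n →
      ∀ (G : SimpleGraph (Fin n)) [DecidableRel G.Adj], G.Connected → ∀ i : Fin n,
      ∃ P : DecOT.Program
          (DecOT.AgentInput (Fin n) (DecOT.MargRow n) (G.neighborSet i))
          (DecOT.AgentOutput (Fin n) (DecOT.MargRow n)),
        P.opCount ≤ c₁ * (G.degree i * n) ∧
        ∀ (p q c : Fin n → ℝ) (η ρ β τ : ℝ), 0 < η → 0 < ρ → 0 < β → 0 < τ →
          DecOT.Implements P (DecOT.otAgent p q i c η ρ β τ)) ∧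
    -- arithmetic cost `O(n² + |𝒩ᵢ| (2n + N))` for decentralized equitable optimal transport
    (∃ c₂ : ℕ, ∀ (n N : ℕ), 1 ≤ n → 2 ≤ N →
      ∀ (G : SimpleGraph (Fin N)) [DecidableRel G.Adj], G.Connected → ∀ i : Fin N,
      ∃ P : DecOT.Program
          (DecOT.AgentInput (Fin n × Fin n) (DecOT.MargRow n ⊕ Fin (N - 1)) (G.neighborSet i))
          (DecOT.AgentOutput (Fin n × Fin n) (DecOT.MargRow n ⊕ Fin (N - 1))),
        P.opCount ≤ c₂ * (n ^ 2 + G.degree i * (2 * n + N)) ∧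
        ∀ (p q : Fin n → ℝ) (C : Matrix (Fin n) (Fin n) ℝ) (η ρ β τ : ℝ),
          0 < η → 0 < ρ → 0 < β → 0 < τ →
          DecOT.Implements P (DecOT.eotAgent G p q i C η ρ β τ)) := by
  refine ⟨?_, ?_, DecOT.exists_ot_program, DecOT.exists_eot_program⟩
  · intro n hn G _ hG p q hp hq C _
    exact DecOT.ot_convergence n hn G hG p q hp hq C
  · intro n N _ hN G _ hG p q hp hq C hC
    exact DecOT.eot_convergence n N hN G hG p q hp hq C hC
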